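/- Let $I_\nu(z)=\sum_{k\ge 0}\frac{(z/2)^{2k+\nu}}{k!\,\Gamma(k+\nu+1)}$ be the modified Bessel function of the first kind and $K_\nu(z)=\frac{\pi}{2}\,\frac{I_{-\nu}(z)-I_\nu(z)}{\sin(\nu\pi)}$ (with the limiting value at integer $\nu$) the Macdonald function, and let $(a)_m=a(a+1)\cdots(a+m-1)$. Let $N\ge 0$ be an integer and $X>0$. For $\tau>0$ put $$r(\tau)=\exp\left(\int_0^\infty e^{-i\tau t}\left[\frac12-\frac1t+\frac1{e^t-1}\right]\frac{dt}{t}\right)-1,$$ where the integral converges as an improper integral, that is, as $\lim_{T\to\infty}\int_0^T$. For $x\in(0,X]$ and $\tau>0$ put $$R_N(\tau)=\operatorname{Re}\left[e^{i\left(\tau\log\frac{2\tau}{ex}-\frac{\pi}{4}\right)}\left\{r(\tau)+(1+r(\tau))\left[\sum_{m=1}^N\frac{(x/2)^{2m}}{m!\,(1-i\tau)_m}+\frac{x^{2i\tau}}{2^N(1-i\tau)_N}\int_0^x(x^2-y^2)^{N-i\tau}I_{N+1}(y)\frac{dy}{y^N}\right]\right\}\right].$$ Then for every $x\in(0,X]$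 and $\tau>0$ the integral over $(0,x)$ converges absolutely and $$K_{i\tau}(x)=\sqrt{\frac{2\pi}{\tau}}\;e^{-\pi\tau/2}\left[\cos\left(\tau\log\frac{2\tau}{ex}-\frac{\pi}{4}\right)+R_N(\tau)\right].$$ Moreover $R_N(\tau)=O(1/\tau)$ as $\tau\to+\infty$, and for all $x\in(0,X]$ and all $\tau\ge\tau_0>0$ $$|R_N(\tau)|\le\frac1\tau\left[\frac{e^{1/(6\tau_0)}}{6}+\left(\tau_0+\frac{e^{1/(6\tau_0)}}{6}\right)\left[\exp\left(\frac{X^2}{4\tau_0}\right)+\left(\frac{X^2}{2\tau_0}\right)^N\left(\frac{I_N(X)}{X^N}-\frac1{2^N N!}\right)\right]\right].$$ -/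

import Mathlib

open Filter Topology MeasureTheory

noncomputable section

/-- The modified Bessel function of the first kind
`I_ν(z) = ∑_{k ≥ 0} (z/2)^(2k+ν) / (k! Γ(k+ν+1))` (principal branch of the power).
`Complex.Gamma` is `0` at its poles, so `1 / Γ` takes its usual value `0` there. -/
def besselI (ν z : ℂ) : ℂ :=
  ∑' k : ℕ, (z / 2) ^ (2 * (k : ℂ) + ν) / ((k.factorial : ℂ) * Complex.Gamma ((k : ℂ) + ν + 1))

/-- The quotient `(π / 2) (I_{-ν}(z) - I_ν(z)) / sin (ν π)`. -/
def besselKQuot (z ν : ℂ) : ℂ :=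
  (Real.pi : ℂ) / 2 * (besselI (-ν) z - besselI ν z) / Complex.sin (ν * (Real.pi : ℂ))

open scoped Classical in
/-- The modified Bessel function of the second kind (Macdonald function) `K_ν(z)`:
`(π / 2) (I_{-ν}(z) - I_ν(z)) / sin (ν π)` for non-integer `ν`, and the limit of this expression
in `ν` at the integers. -/
def besselK (ν z : ℂ) : ℂ :=
  if Complex.sin (ν * (Real.pi : ℂ)) = 0 then limUnder (𝓝[≠] ν) (besselKQuot z)
  else besselKQuot z ν

/-- The integrand `e^{-iτt} [1/2 - 1/t + 1/(e^t - 1)] / t` of the Binet integral on the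
imaginary axis. -/
def binetIntegrand (τ t : ℝ) : ℂ :=
  Complex.exp (-(Complex.I * (τ : ℂ) * (t : ℂ))) *
    (((1 / 2 - 1 / t + 1 / (Real.exp t - 1)) / t : ℝ) : ℂ)

/-- The Binet integral `∫_0^∞ e^{-iτt} [1/2 - 1/t + 1/(e^t - 1)] dt/t`. It converges only
conditionally, so it is the limit of the integrals over `[0, T]` as `T → ∞`. -/
def binetIntegral (τ : ℝ) : ℂ :=
  limUnder atTop (fun T : ℝ => ∫ t in (0 : ℝ)..T, binetIntegrand τ t)

/-- The Binet–Stirling remainder `r(τ)` of `Γ(iτ)`. -/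
def stirlingRemainder (τ : ℝ) : ℂ :=
  Complex.exp (binetIntegral τ) - 1

/-- The Pochhammer symbol `(1 - iτ)_m`. -/
def pochOneSub (τ : ℝ) (m : ℕ) : ℂ :=
  (ascPochhammer ℂ m).eval (1 - Complex.I * (τ : ℂ))

/-- The phase `τ log (2τ / (e x)) - π/4`. -/
def phase (x τ : ℝ) : ℝ :=
  τ * Real.log (2 * τ / (Real.exp 1 * x)) - Real.pi / 4

/-- The integrand `(x² - y²)^{N - iτ} I_{N+1}(y) / y^N`. -/
def remainderIntegrand (N : ℕ) (x τ y : ℝ) : ℂ :=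
  ((x ^ 2 - y ^ 2 : ℝ) : ℂ) ^ ((N : ℂ) - Complex.I * (τ : ℂ)) *
    besselI ((N : ℂ) + 1) (y : ℂ) / (y : ℂ) ^ N

/-- The remainder term `R_N(τ)` (which also depends on `x`). -/
def remainder (N : ℕ) (x τ : ℝ) : ℝ :=
  (Complex.exp (Complex.I * (phase x τ : ℂ)) *
    (stirlingRemainder τ + (1 + stirlingRemainder τ) *
      (∑ m ∈ Finset.Icc 1 N,
          ((x : ℂ) / 2) ^ (2 * m) / ((m.factorial : ℂ) * pochOneSub τ m) +
        (x : ℂ) ^ (2 * Complex.I * (τ : ℂ)) / ((2 : ℂ) ^ N * pochOneSub τ N) *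
          ∫ y in (0 : ℝ)..x, remainderIntegrand N x τ y))).re

/-- For a non-negative integer order and a real argument `I_n(x)` is real, so that
nothing is lost by passing to its real part. -/
theorem besselI_natCast_im (n : ℕ) (x : ℝ) : (besselI (n : ℂ) (x : ℂ)).im = 0 := by
  have h : besselI (n : ℂ) (x : ℂ) =
      ((∑' k : ℕ, (x / 2) ^ (2 * k + n) /
        ((k.factorial : ℝ) * ((k + n).factorial : ℝ)) : ℝ) : ℂ) := by
    rw [besselI, Complex.ofReal_tsum]
    refine tsum_congr fun k => ?_
    have h1 : (2 * (k : ℂ) + (n : ℂ)) = ((2 * k + n : ℕ) : ℂ) := by push_cast; ring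
    have h2 : ((k : ℂ) + (n : ℂ) + 1) = ((k + n : ℕ) : ℂ) + 1 := by push_cast; ring
    rw [h1, h2, Complex.cpow_natCast, Complex.Gamma_nat_eq_factorial]
    push_cast
    ring
  rw [h, Complex.ofReal_im]

end

/-! Write S for the power series `besselSeries` attached to I_{-iτ}. The functions I_{iτ}(x) and
I_{-iτ}(x) are complex conjugates, so their difference is an imaginary part. The reflection formula
then turns K_{iτ}(x) into the real part of (x/2)^{-iτ} Γ(iτ) S. Binet's formula on the imaginary
axis splits Γ(iτ) into the modulus sqrt(2π/τ) e^{-πτ/2}, an elementary phase and the factor 1 +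
r(τ). What remains is Re[e^{i phase} (1 + r) S], which is the cosine plus R_N once S is cut after
the term of index N: integrating the series of I_{N+1} termwise against (x² - y²)^{N-iτ} reproduces
the tail of S exactly (`tail_besselSeries_eq`). Hence R_N does not depend on N.

The analytic core is Binet's formula up to the imaginary axis, where the integral converges only
conditionally. The Binet kernel decreases from 1/12 to 0, so its derivative is integrable with total
mass 1/12. One integration by parts yields an absolutely convergent form μ(z) (`binetFun`),
continuous on the closed right half plane away from 0 and bounded by 1/(6|z|). In the open half
plane, the difference equation for μ and Euler's limit identify Γ up to a constant, Stirling's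
formula gives the constant, and continuity carries the result to the axis.

For the bound, |e^μ - 1| ≤ |μ| e^{|μ|} controls r, and |(1-iτ)_k| ≥ τ^k compares S - 1 with an
exponential series. The resulting estimate is stronger than the stated one, whose term in I_N is
nonnegative. -/

/-! ### Monotonicity and limits of the Binet kernel. -/

theorem nonneg_of_hasDerivAt_nonneg {f f' : ℝ → ℝ} (hf : ∀ t, HasDerivAt f (f' t) t)
    (h0 : f 0 = 0) (hf' : ∀ t, 0 ≤ t → 0 ≤ f' t) (t : ℝ) (ht : 0 ≤ t) : 0 ≤ f t := by
  have hm : MonotoneOn f (Set.Ici 0) := by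
    refine monotoneOn_of_hasDerivWithinAt_nonneg (f' := f') (convex_Ici 0)
      (fun x _ => (hf x).continuousAt.continuousWithinAt)
      (fun x _ => (hf x).hasDerivWithinAt) fun x hx => ?_
    rw [interior_Ici] at hx
    exact hf' x hx.le
  have := hm (Set.mem_Ici.2 le_rfl) (Set.mem_Ici.2 ht) ht
  rwa [h0] at this

/-- The difference of the two sides and its first three derivatives vanish at 0, and the fourth
derivative is t sinh t / 4 ≥ 0. Multiplied by 8e^t, this is the inequality that makes the Binet
kernel decreasing. -/
theorem cosh_sub_one_le (t : ℝ) (ht : 0 ≤ t) :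
    Real.cosh t - 1 ≤ t ^ 2 / 4 + t * Real.sinh t / 4 := by
  have h1 : ∀ t : ℝ, 0 ≤ t → 0 ≤ t * Real.cosh t - Real.sinh t := by
    refine nonneg_of_hasDerivAt_nonneg (f' := fun t => t * Real.sinh t) (fun t => ?_) (by simp)
      fun t ht => mul_nonneg ht (Real.sinh_nonneg_iff.2 ht)
    refine (((hasDerivAt_id' t).mul (Real.hasDerivAt_cosh t)).sub
      (Real.hasDerivAt_sinh t)).congr_deriv ?_
    ring
  have h2 : ∀ t : ℝ, 0 ≤ t → 0 ≤ 1 / 2 - Real.cosh t / 2 + t * Real.sinh t / 4 := by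
    refine nonneg_of_hasDerivAt_nonneg (f' := fun t => (t * Real.cosh t - Real.sinh t) / 4)
      (fun t => ?_) (by simp) fun t ht => div_nonneg (h1 t ht) (by norm_num)
    refine ((((Real.hasDerivAt_cosh t).div_const 2).const_sub (1 / 2)).add
      (((hasDerivAt_id' t).mul (Real.hasDerivAt_sinh t)).div_const 4)).congr_deriv ?_
    ring
  have h3 : ∀ t : ℝ, 0 ≤ t → 0 ≤ t / 2 + t * Real.cosh t / 4 - 3 / 4 * Real.sinh t := by
    refine nonneg_of_hasDerivAt_nonneg
      (f' := fun t => 1 / 2 - Real.cosh t / 2 + t * Real.sinh t / 4)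
      (fun t => ?_) (by simp) h2
    refine ((((hasDerivAt_id' t).div_const 2).add
      (((hasDerivAt_id' t).mul (Real.hasDerivAt_cosh t)).div_const 4)).sub
      ((Real.hasDerivAt_sinh t).const_mul (3 / 4))).congr_deriv ?_
    ring
  have h4 : 0 ≤ t ^ 2 / 4 + t * Real.sinh t / 4 - Real.cosh t + 1 := by
    refine nonneg_of_hasDerivAt_nonneg
      (f := fun t => t ^ 2 / 4 + t * Real.sinh t / 4 - Real.cosh t + 1)
      (f' := fun t => t / 2 + t * Real.cosh t / 4 - 3 / 4 * Real.sinh t)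
      (fun t => ?_) (by simp) h3 t ht
    refine (((((hasDerivAt_pow 2 t).div_const 4).add
      (((hasDerivAt_id' t).mul (Real.hasDerivAt_sinh t)).div_const 4)).sub
      (Real.hasDerivAt_cosh t)).add_const 1).congr_deriv ?_
    norm_num; ring
  linarith

/-- The Binet kernel `(1/2 - 1/t + 1/(e^t - 1)) / t`, continuously extended to `t = 0`. -/
noncomputable def binetKernel (t : ℝ) : ℝ :=
  if t = 0 then 1 / 12 else (1 / 2 - 1 / t + 1 / (Real.exp t - 1)) / t

/-- The derivative of the Binet kernel on `(0, ∞)`. -/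
noncomputable def binetKernelDeriv (t : ℝ) : ℝ :=
  ((1 / t ^ 2 - Real.exp t / (Real.exp t - 1) ^ 2) * t
    - (1 / 2 - 1 / t + 1 / (Real.exp t - 1))) / t ^ 2

theorem binetKernel_of_pos {t : ℝ} (ht : 0 < t) :
    binetKernel t = (1 / 2 - 1 / t + 1 / (Real.exp t - 1)) / t := if_neg ht.ne'

theorem exp_sub_one_pos {t : ℝ} (ht : 0 < t) : 0 < Real.exp t - 1 := by
  have := Real.add_one_lt_exp ht.ne'
  linarith

theorem hasDerivAt_binetKernel {t : ℝ} (ht : 0 < t) :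
    HasDerivAt binetKernel (binetKernelDeriv t) t := by
  have hE := exp_sub_one_pos ht
  have h : HasDerivAt (fun t : ℝ => (1 / 2 - 1 / t + 1 / (Real.exp t - 1)) / t)
      (binetKernelDeriv t) t := by
    have h1 := (((hasDerivAt_inv ht.ne').const_sub (1 / 2)).add
      (((Real.hasDerivAt_exp t).sub_const 1).inv hE.ne')).div (hasDerivAt_id t) ht.ne'
    refine (h1.congr_deriv ?_).congr_of_eventuallyEq ?_
    · simp only [binetKernelDeriv, id, Pi.add_apply, Pi.inv_apply]; ring
    · refine Eventually.of_forall fun s => ?_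
      simp
  refine h.congr_of_eventuallyEq ?_
  filter_upwards [lt_mem_nhds ht] with s hs using binetKernel_of_pos hs

theorem binetKernelDeriv_nonpos {t : ℝ} (ht : 0 < t) : binetKernelDeriv t ≤ 0 := by
  have hE := exp_sub_one_pos ht
  have hE0 := Real.exp_pos t
  have key := cosh_sub_one_le t ht.le
  rw [Real.cosh_eq, Real.sinh_eq, Real.exp_neg] at key
  set E := Real.exp t with hEdef
  have key2 : 4 * (E - 1) ^ 2 ≤ t * (E ^ 2 - 1) + 2 * t ^ 2 * E := by
    have := mul_le_mul_of_nonneg_left key (by positivity : 0 ≤ 8 * E)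
    field_simp at this
    nlinarith
  have : binetKernelDeriv t =
      -((t * (E ^ 2 - 1) + 2 * t ^ 2 * E - 4 * (E - 1) ^ 2) / (2 * t ^ 3 * (E - 1) ^ 2)) := by
    rw [binetKernelDeriv, ← hEdef]
    field_simp
    ring
  rw [this, neg_nonpos]
  exact div_nonneg (by linarith) (by positivity)

/-- Gives continuity of the kernel at 0. Over the denominator 12t²(e^t - 1), of order t³, the
numerator is O(t⁴), which a cubic Taylor expansion of e^t detects. -/
theorem abs_binetKernel_sub_le {t : ℝ} (ht : 0 < t) (ht1 : t ≤ 1) :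
    |binetKernel t - 1 / 12| ≤ t := by
  have hE := exp_sub_one_pos ht
  have h := Real.exp_bound (x := t) (by rwa [abs_of_pos ht]) (n := 4) (by norm_num)
  simp only [Finset.sum_range_succ, Finset.sum_range_zero, abs_of_pos ht] at h
  norm_num [Nat.factorial] at h
  have hE1 : t ≤ Real.exp t - 1 := by linarith [Real.add_one_le_exp t]
  set E := Real.exp t with hEdef
  obtain ⟨ρ, hρ⟩ : ∃ ρ, ρ = E - (1 + t + t ^ 2 / 2 + t ^ 3 / 6) := ⟨_, rfl⟩
  rw [← hρ] at h
  have hEρ : E = 1 + t + t ^ 2 / 2 + t ^ 3 / 6 + ρ := by rw [hρ]; ring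
  have e1 : binetKernel t - 1 / 12 =
      (t ^ 4 / 2 - t ^ 5 / 6 + (6 * t - 12 - t ^ 2) * ρ) / (12 * t ^ 2 * (E - 1)) := by
    have : t ^ 4 / 2 - t ^ 5 / 6 + (6 * t - 12 - t ^ 2) * ρ =
        6 * (t * E - 2 * E + t + 2) - t ^ 2 * (E - 1) := by rw [hEρ]; ring
    rw [this, binetKernel_of_pos ht, ← hEdef]
    field_simp
    ring
  rw [e1, abs_div, abs_of_pos (show 0 < 12 * t ^ 2 * (E - 1) by positivity),
    div_le_iff₀ (by positivity)]
  have h2 : |(6 * t - 12 - t ^ 2) * ρ| ≤ 12 * (t ^ 4 * (5 / 96)) := by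
    rw [abs_mul]
    refine mul_le_mul ?_ h (abs_nonneg _) (by norm_num)
    rw [abs_le]; constructor <;> nlinarith
  have h3 : |t ^ 4 / 2 - t ^ 5 / 6| ≤ t ^ 4 := by
    have h5 : t ^ 5 ≤ t ^ 4 := pow_le_pow_of_le_one ht.le ht1 (by norm_num)
    have h50 : 0 < t ^ 5 := by positivity
    rw [abs_le]; constructor <;> linarith
  have h4 : t ^ 4 * 12 ≤ t * (12 * t ^ 2 * (E - 1)) := by
    have := mul_le_mul_of_nonneg_left hE1 (show 0 ≤ 12 * t ^ 3 by positivity)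
    nlinarith
  have h6 : 0 < t ^ 4 := by positivity
  calc _ ≤ |t ^ 4 / 2 - t ^ 5 / 6| + |(6 * t - 12 - t ^ 2) * ρ| := abs_add_le _ _
    _ ≤ t ^ 4 * 12 := by linarith
    _ ≤ _ := h4

theorem continuousOn_binetKernel : ContinuousOn binetKernel (Set.Ici 0) := by
  intro t ht
  rcases (Set.mem_Ici.1 ht).eq_or_lt with rfl | h
  · have h0 : binetKernel 0 = 1 / 12 := if_pos rfl
    rw [ContinuousWithinAt, h0, tendsto_iff_norm_sub_tendsto_zero]
    have hid : Tendsto (fun t : ℝ => t) (𝓝[≥] 0) (𝓝 0) := tendsto_id.mono_left nhdsWithin_le_nhds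
    refine squeeze_zero' (Eventually.of_forall fun _ => norm_nonneg _) ?_ hid
    filter_upwards [self_mem_nhdsWithin, nhdsWithin_le_nhds (ge_mem_nhds zero_lt_one)] with t h1 h2
    rcases (Set.mem_Ici.1 h1).eq_or_lt with rfl | h
    · simp [h0]
    · exact abs_binetKernel_sub_le h h2
  · exact (hasDerivAt_binetKernel h).continuousAt.continuousWithinAt

theorem tendsto_binetKernel_atTop : Tendsto binetKernel atTop (𝓝 0) := by
  have h1 : Tendsto (fun t : ℝ => 1 / 2 - t⁻¹ + (Real.exp t - 1)⁻¹) atTop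
      (𝓝 (1 / 2 - 0 + 0)) :=
    (tendsto_inv_atTop_zero.const_sub _).add
      ((tendsto_atTop_add_const_right _ (-1) Real.tendsto_exp_atTop).inv_tendsto_atTop)
  have h2 := h1.mul tendsto_inv_atTop_zero
  rw [mul_zero] at h2
  refine h2.congr' ?_
  filter_upwards [eventually_gt_atTop 0] with t ht
  rw [binetKernel_of_pos ht]
  simp [div_eq_mul_inv]

theorem antitoneOn_binetKernel : AntitoneOn binetKernel (Set.Ici 0) := by
  refine antitoneOn_of_hasDerivWithinAt_nonpos (f' := binetKernelDeriv) (convex_Ici 0)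
    continuousOn_binetKernel (fun x hx => ?_) fun x hx => ?_
  all_goals rw [interior_Ici] at hx
  · exact (hasDerivAt_binetKernel hx).hasDerivWithinAt
  · exact binetKernelDeriv_nonpos hx

theorem binetKernel_nonneg {t : ℝ} (ht : 0 ≤ t) : 0 ≤ binetKernel t := by
  refine le_of_tendsto tendsto_binetKernel_atTop ?_
  filter_upwards [eventually_ge_atTop t] with s hs
  exact antitoneOn_binetKernel ht (ht.trans hs) hs

theorem binetKernel_le {t : ℝ} (ht : 0 ≤ t) : binetKernel t ≤ 1 / 12 := by
  have := antitoneOn_binetKernel (Set.mem_Ici.2 le_rfl) ht ht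
  rwa [show binetKernel 0 = 1 / 12 from if_pos rfl] at this

/-- A derivative of constant sign is integrable as soon as its primitive has limits at both ends;
the mass is then the drop 1/12 - 0. -/
theorem integrableOn_binetKernelDeriv : IntegrableOn binetKernelDeriv (Set.Ioi 0) :=
  integrableOn_Ioi_deriv_of_nonpos (continuousOn_binetKernel 0 (Set.mem_Ici.2 le_rfl))
    (fun _ hx => hasDerivAt_binetKernel hx) (fun _ hx => binetKernelDeriv_nonpos hx)
    tendsto_binetKernel_atTop

theorem integral_norm_binetKernelDeriv :
    ∫ t in Set.Ioi (0 : ℝ), ‖binetKernelDeriv t‖ = 1 / 12 := by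
  have h := integral_Ioi_of_hasDerivAt_of_nonpos
    (continuousOn_binetKernel 0 (Set.mem_Ici.2 le_rfl))
    (fun _ hx => hasDerivAt_binetKernel hx) (fun _ hx => binetKernelDeriv_nonpos hx)
    tendsto_binetKernel_atTop
  rw [show binetKernel 0 = 1 / 12 from if_pos rfl] at h
  have h2 : ∫ t in Set.Ioi (0 : ℝ), ‖binetKernelDeriv t‖ =
      ∫ t in Set.Ioi (0 : ℝ), -binetKernelDeriv t :=
    setIntegral_congr_fun measurableSet_Ioi fun t ht => by
      rw [Real.norm_of_nonpos (binetKernelDeriv_nonpos ht)]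
  rw [h2, integral_neg, h]
  norm_num

/-! ### The Binet function on the closed right half plane. -/

/-- The Binet function `μ(z) = ∫_0^∞ e^{-zt} binetKernel t dt`, in the form obtained by an
integration by parts, which makes sense for `0 ≤ re z`, `z ≠ 0`. -/
noncomputable def binetFun (z : ℂ) : ℂ :=
  (1 / 12 + ∫ t in Set.Ioi (0 : ℝ), Complex.exp (-(z * t)) * (binetKernelDeriv t : ℂ)) / z

theorem norm_exp_neg_mul_le_one {z : ℂ} (hz : 0 ≤ z.re) {t : ℝ} (ht : 0 ≤ t) :
    ‖Complex.exp (-(z * t))‖ ≤ 1 := by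
  rw [Complex.norm_exp]
  simpa using mul_nonneg hz ht

theorem norm_exp_neg_mul (z : ℂ) (t : ℝ) :
    ‖Complex.exp (-(z * t))‖ = Real.exp (-(z.re * t)) := by
  rw [Complex.norm_exp]; simp

theorem integrableOn_exp_mul_binetKernelDeriv {z : ℂ} (hz : 0 ≤ z.re) :
    IntegrableOn (fun t : ℝ => Complex.exp (-(z * t)) * (binetKernelDeriv t : ℂ))
      (Set.Ioi 0) := by
  have h : IntegrableOn (fun t => (binetKernelDeriv t : ℂ)) (Set.Ioi 0) :=
    integrableOn_binetKernelDeriv.ofReal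
  refine h.bdd_mul (c := 1) (Continuous.aestronglyMeasurable (by fun_prop)) ?_
  filter_upwards [ae_restrict_mem measurableSet_Ioi] with t ht
  exact norm_exp_neg_mul_le_one hz (le_of_lt ht)

theorem norm_integral_exp_mul_binetKernelDeriv_le {z : ℂ} (hz : 0 ≤ z.re) :
    ‖∫ t in Set.Ioi (0 : ℝ), Complex.exp (-(z * t)) * (binetKernelDeriv t : ℂ)‖ ≤ 1 / 12 := by
  rw [← integral_norm_binetKernelDeriv]
  refine norm_integral_le_of_norm_le integrableOn_binetKernelDeriv.norm ?_
  filter_upwards [ae_restrict_mem measurableSet_Ioi] with t ht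
  rw [norm_mul, Complex.norm_real]
  exact mul_le_of_le_one_left (norm_nonneg _) (norm_exp_neg_mul_le_one hz (le_of_lt ht))

/-- The constant 1/6 is 1/12 from the boundary term at 0 plus 1/12 from the total variation of the
kernel. -/
theorem norm_binetFun_le {z : ℂ} (hz : 0 ≤ z.re) : ‖binetFun z‖ ≤ 1 / (6 * ‖z‖) := by
  have h : ‖(1 / 12 + ∫ t in Set.Ioi (0 : ℝ),
      Complex.exp (-(z * t)) * (binetKernelDeriv t : ℂ))‖ ≤ 1 / 6 := by
    refine (norm_add_le _ _).trans ?_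
    have := norm_integral_exp_mul_binetKernelDeriv_le hz
    have h2 : ‖(1 / 12 : ℂ)‖ = 1 / 12 := by norm_num
    linarith
  rw [binetFun, norm_div, ← div_div]
  exact div_le_div_of_nonneg_right h (norm_nonneg _)

/-- Integration by parts on [0, T]. The boundary term at T vanishes in the limit because the kernel
tends to 0, even when the exponential does not decay. -/
theorem tendsto_integral_exp_mul_binetKernel {z : ℂ} (hz : 0 ≤ z.re) (hz0 : z ≠ 0) :
    Tendsto (fun T : ℝ => ∫ t in (0 : ℝ)..T, Complex.exp (-(z * t)) * (binetKernel t : ℂ))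
      atTop (𝓝 (binetFun z)) := by
  have hparts : ∀ T : ℝ, 0 < T →
      ∫ t in (0 : ℝ)..T, Complex.exp (-(z * t)) * (binetKernel t : ℂ) =
        (1 / 12 - Complex.exp (-(z * T)) * (binetKernel T : ℂ) +
          ∫ t in (0 : ℝ)..T, Complex.exp (-(z * t)) * (binetKernelDeriv t : ℂ)) / z := by
    intro T hT
    have hd : ∀ t : ℝ, HasDerivAt (fun t : ℝ => -(Complex.exp (-(z * t)) / z))
        (Complex.exp (-(z * t))) t := by
      intro t
      have h1 : HasDerivAt (fun t : ℝ => -(z * (t : ℂ))) (-(z * 1)) t :=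
        ((Complex.ofRealCLM.hasDerivAt (x := t)).const_mul z).neg
      refine (h1.cexp.div_const z).neg.congr_deriv ?_
      field_simp
    have hi : IntervalIntegrable (fun t => (binetKernelDeriv t : ℂ)) volume 0 T := by
      rw [intervalIntegrable_iff_integrableOn_Ioc_of_le hT.le]
      have h : IntegrableOn (fun t => (binetKernelDeriv t : ℂ)) (Set.Ioi 0) :=
        integrableOn_binetKernelDeriv.ofReal
      exact h.mono_set Set.Ioc_subset_Ioi_self
    have h := intervalIntegral.integral_mul_deriv_eq_deriv_mul_of_hasDerivAt
      (a := 0) (b := T) (u := fun t => (binetKernel t : ℂ))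
      (u' := fun t => (binetKernelDeriv t : ℂ))
      (v := fun t : ℝ => -(Complex.exp (-(z * t)) / z))
      (v' := fun t : ℝ => Complex.exp (-(z * t)))
      (by
        rw [Set.uIcc_of_le hT.le]
        exact Complex.continuous_ofReal.comp_continuousOn
          (continuousOn_binetKernel.mono Set.Icc_subset_Ici_self))
      (by fun_prop)
      (fun t ht => by
        rw [min_eq_left hT.le] at ht
        exact (hasDerivAt_binetKernel ht.1).ofReal_comp)
      (fun t _ => hd t) hi (Continuous.intervalIntegrable (by fun_prop) _ _)
    rw [show (binetKernel 0 : ℝ) = 1 / 12 from if_pos rfl] at h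
    simp_rw [mul_comm (Complex.exp _)]
    rw [h]
    have h2 : ∫ t in (0 : ℝ)..T, (binetKernelDeriv t : ℂ) * -(Complex.exp (-(z * t)) / z) =
        -((∫ t in (0 : ℝ)..T, (binetKernelDeriv t : ℂ) * Complex.exp (-(z * t))) / z) := by
      rw [← intervalIntegral.integral_div, ← intervalIntegral.integral_neg]
      refine intervalIntegral.integral_congr fun t _ => ?_
      ring
    rw [h2]
    push_cast
    simp only [mul_zero, neg_zero, Complex.exp_zero]
    ring
  have h1 : Tendsto (fun T : ℝ => Complex.exp (-(z * T)) * (binetKernel T : ℂ)) atTop (𝓝 0) := by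
    refine squeeze_zero_norm' ?_ tendsto_binetKernel_atTop
    filter_upwards [eventually_ge_atTop 0] with T hT
    rw [norm_mul, Complex.norm_real, Real.norm_of_nonneg (binetKernel_nonneg hT)]
    exact mul_le_of_le_one_left (binetKernel_nonneg hT) (norm_exp_neg_mul_le_one hz hT)
  have h2 := intervalIntegral_tendsto_integral_Ioi 0
    (integrableOn_exp_mul_binetKernelDeriv hz) tendsto_id
  have h3 := ((h1.const_sub (1 / 12)).add h2).div_const z
  rw [sub_zero] at h3
  refine h3.congr' ?_
  filter_upwards [eventually_gt_atTop 0] with T hT using (hparts T hT).symm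

theorem integrableOn_exp_neg_mul {z : ℂ} (hz : 0 < z.re) :
    IntegrableOn (fun t : ℝ => Complex.exp (-(z * t))) (Set.Ioi 0) := by
  have := integrableOn_exp_mul_complex_Ioi (a := -z) (by simpa using hz) 0
  simpa using this

theorem integrableOn_exp_mul_binetKernel {z : ℂ} (hz : 0 < z.re) :
    IntegrableOn (fun t : ℝ => Complex.exp (-(z * t)) * (binetKernel t : ℂ)) (Set.Ioi 0) := by
  refine (integrableOn_exp_neg_mul hz).mul_bdd (c := 1 / 12) ?_ ?_
  · exact ((Complex.continuous_ofReal.comp_continuousOn continuousOn_binetKernel).mono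
      Set.Ioi_subset_Ici_self).aestronglyMeasurable measurableSet_Ioi
  · filter_upwards [ae_restrict_mem measurableSet_Ioi] with t ht
    rw [Complex.norm_real, Real.norm_of_nonneg (binetKernel_nonneg (le_of_lt ht))]
    exact binetKernel_le (le_of_lt ht)

theorem integral_exp_mul_binetKernel {z : ℂ} (hz : 0 < z.re) :
    ∫ t in Set.Ioi (0 : ℝ), Complex.exp (-(z * t)) * (binetKernel t : ℂ) = binetFun z := by
  have hz0 : z ≠ 0 := fun h => by simp [h] at hz
  exact tendsto_nhds_unique
    (intervalIntegral_tendsto_integral_Ioi 0 (integrableOn_exp_mul_binetKernel hz) tendsto_id)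
    (tendsto_integral_exp_mul_binetKernel hz.le hz0)

/-- Dominated convergence with majorant the absolute value of the kernel's derivative, valid up to
the imaginary axis. -/
theorem continuousWithinAt_binetFun {z : ℂ} (hz0 : z ≠ 0) :
    ContinuousWithinAt binetFun {w | 0 ≤ w.re} z := by
  refine ContinuousWithinAt.div (continuousWithinAt_const.add ?_) continuousWithinAt_id hz0
  refine continuousWithinAt_of_dominated (bound := fun t => ‖binetKernelDeriv t‖) ?_ ?_
    integrableOn_binetKernelDeriv.norm ?_
  · filter_upwards [self_mem_nhdsWithin] with w hw
    exact (integrableOn_exp_mul_binetKernelDeriv hw).aestronglyMeasurable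
  · filter_upwards [self_mem_nhdsWithin] with w hw
    filter_upwards [ae_restrict_mem measurableSet_Ioi] with t ht
    rw [norm_mul, Complex.norm_real]
    exact mul_le_of_le_one_left (norm_nonneg _) (norm_exp_neg_mul_le_one hw (le_of_lt ht))
  · refine Eventually.of_forall fun t => Continuous.continuousWithinAt ?_
    fun_prop

/-! ### The difference equation of the Binet function. -/

/-- Amounts to (1 - e^{-t}) times the kernel being ∫₀¹ (1/2 - u) e^{-ut} du; this lets the
difference of two Laplace transforms be computed by Fubini. -/
theorem integral_half_sub_mul_exp (z : ℂ) {t : ℝ} (ht : 0 < t) :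
    ∫ u in (0 : ℝ)..1, (1 / 2 - (u : ℂ)) * Complex.exp (-((z + u) * t)) =
      Complex.exp (-(z * t)) * binetKernel t - Complex.exp (-((z + 1) * t)) * binetKernel t := by
  have ht0 : (t : ℂ) ≠ 0 := Complex.ofReal_ne_zero.2 ht.ne'
  have hd : ∀ u : ℝ, HasDerivAt
      (fun u : ℝ => Complex.exp (-((z + u) * t)) * (((u : ℂ) - 1 / 2) / t + 1 / (t : ℂ) ^ 2))
      ((1 / 2 - (u : ℂ)) * Complex.exp (-((z + u) * t))) u := by
    intro u
    have h0 : HasDerivAt (fun u : ℝ => (u : ℂ)) 1 u := Complex.ofRealCLM.hasDerivAt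
    have h1 : HasDerivAt (fun u : ℝ => -((z + u) * (t : ℂ))) (-(1 * (t : ℂ))) u :=
      ((h0.const_add z).mul_const _).neg
    refine (h1.cexp.mul (((h0.sub_const (1 / 2)).div_const (t : ℂ)).add_const
      (1 / (t : ℂ) ^ 2))).congr_deriv ?_
    field_simp
    ring
  rw [intervalIntegral.integral_eq_sub_of_hasDerivAt (fun u _ => hd u)
    (Continuous.intervalIntegrable (by fun_prop) _ _)]
  have hE : (Real.exp t : ℂ) - 1 ≠ 0 := by
    have := (exp_sub_one_pos ht).ne'
    exact_mod_cast this
  have hE0 : (Real.exp t : ℂ) ≠ 0 := Complex.ofReal_ne_zero.2 (Real.exp_pos t).ne'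
  have h1 : Complex.exp (-((z + 1) * t)) = Complex.exp (-(z * t)) * (Real.exp t : ℂ)⁻¹ := by
    rw [Complex.ofReal_exp, ← Complex.exp_neg, ← Complex.exp_add]
    congr 1; ring
  rw [binetKernel_of_pos ht]
  push_cast
  push_cast at h1 hE hE0
  rw [h1, add_zero]
  field_simp
  ring

theorem integral_half_sub_div {z : ℂ} (hz : 0 < z.re) :
    ∫ u in (0 : ℝ)..1, (1 / 2 - (u : ℂ)) / (z + u) =
      (z + 1 / 2) * (Complex.log (z + 1) - Complex.log z) - 1 := by
  have hs : ∀ u ∈ Set.uIcc (0 : ℝ) 1, z + (u : ℂ) ∈ Complex.slitPlane := by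
    intro u hu
    rw [Set.uIcc_of_le zero_le_one] at hu
    exact Or.inl (by simpa using add_pos_of_pos_of_nonneg hz hu.1)
  have hd : ∀ u ∈ Set.uIcc (0 : ℝ) 1, HasDerivAt
      (fun u : ℝ => (z + 1 / 2) * Complex.log (z + u) - (u : ℂ))
      ((1 / 2 - (u : ℂ)) / (z + u)) u := by
    intro u hu
    have h0 : HasDerivAt (fun u : ℝ => (u : ℂ)) 1 u := Complex.ofRealCLM.hasDerivAt
    have hne := Complex.slitPlane_ne_zero (hs u hu)
    refine ((((h0.const_add z).clog_real (hs u hu)).const_mul (z + 1 / 2)).sub h0).congr_deriv ?_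
    field_simp
    ring
  rw [intervalIntegral.integral_eq_sub_of_hasDerivAt hd]
  · push_cast
    rw [add_zero]
    ring
  · refine ContinuousOn.intervalIntegrable (ContinuousOn.div (by fun_prop) (by fun_prop) ?_)
    exact fun u hu => Complex.slitPlane_ne_zero (hs u hu)

theorem binetFun_sub_binetFun_add_one {z : ℂ} (hz : 0 < z.re) :
    binetFun z - binetFun (z + 1) =
      (z + 1 / 2) * (Complex.log (z + 1) - Complex.log z) - 1 := by
  have hz1 : 0 < (z + 1).re := by simp; linarith
  rw [← integral_exp_mul_binetKernel hz, ← integral_exp_mul_binetKernel hz1,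
    ← integral_sub (integrableOn_exp_mul_binetKernel hz) (integrableOn_exp_mul_binetKernel hz1),
    ← integral_half_sub_div hz]
  have h1 : ∫ t in Set.Ioi (0 : ℝ), (Complex.exp (-(z * t)) * (binetKernel t : ℂ) -
        Complex.exp (-((z + 1) * t)) * (binetKernel t : ℂ)) =
      ∫ t in Set.Ioi (0 : ℝ), ∫ u in Set.Ioc (0 : ℝ) 1,
        (1 / 2 - (u : ℂ)) * Complex.exp (-((z + u) * t)) :=
    setIntegral_congr_fun measurableSet_Ioi fun t ht => by
      rw [← intervalIntegral.integral_of_le zero_le_one]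
      exact (integral_half_sub_mul_exp z ht).symm
  have hint : Integrable (Function.uncurry fun (t u : ℝ) =>
      (1 / 2 - (u : ℂ)) * Complex.exp (-((z + u) * t)))
      ((volume.restrict (Set.Ioi (0 : ℝ))).prod (volume.restrict (Set.Ioc (0 : ℝ) 1))) := by
    have hb : Integrable (fun p : ℝ × ℝ => ‖Complex.exp (-(z * p.1))‖ * (1 : ℝ))
        ((volume.restrict (Set.Ioi (0 : ℝ))).prod (volume.restrict (Set.Ioc (0 : ℝ) 1))) :=
      (integrableOn_exp_neg_mul hz).norm.mul_prod
        (integrableOn_const (by simp) : IntegrableOn (fun _ => (1 : ℝ)) (Set.Ioc (0 : ℝ) 1))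
    refine hb.mono' (Continuous.aestronglyMeasurable (by unfold Function.uncurry; fun_prop)) ?_
    rw [Measure.prod_restrict]
    filter_upwards [ae_restrict_mem (measurableSet_Ioi.prod measurableSet_Ioc)] with p hp
    obtain ⟨hp1, hp2, hp3⟩ := hp
    have hp1' : (0 : ℝ) < p.1 := hp1
    simp only [Function.uncurry]
    rw [norm_mul, mul_comm]
    have e1 : ‖(1 / 2 - (p.2 : ℂ))‖ ≤ 1 := by
      rw [show (1 / 2 - (p.2 : ℂ)) = ((1 / 2 - p.2 : ℝ) : ℂ) by push_cast; ring,
        Complex.norm_real, Real.norm_eq_abs, abs_le]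
      constructor <;> linarith
    refine mul_le_mul ?_ e1 (norm_nonneg _) (norm_nonneg _)
    rw [norm_exp_neg_mul, norm_exp_neg_mul, Real.exp_le_exp]
    simp only [Complex.add_re, Complex.ofReal_re]
    nlinarith
  rw [h1, integral_integral_swap hint, intervalIntegral.integral_of_le zero_le_one]
  refine setIntegral_congr_fun measurableSet_Ioc fun u hu => ?_
  have hre : (-(z + u)).re < 0 := by
    simp only [Complex.neg_re, Complex.add_re, Complex.ofReal_re]
    linarith [hu.1]
  have h2 := integral_exp_mul_complex_Ioi hre 0
  simp only [integral_const_mul]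
  have h3 : ∫ t in Set.Ioi (0 : ℝ), Complex.exp (-((z + u) * t)) = 1 / (z + u) := by
    simp only [neg_mul] at h2
    rw [h2, Complex.ofReal_zero, mul_zero, neg_zero, Complex.exp_zero, neg_div_neg_eq]
  rw [h3]
  ring

/-! ### Binet's formula for the Gamma function. -/

/-- The logarithm of `Γ(z) / √(2π)` in Binet's form. -/
noncomputable def binetLogGamma (z : ℂ) : ℂ :=
  (z - 1 / 2) * Complex.log z - z + binetFun z

theorem binetLogGamma_add_one {z : ℂ} (hz : 0 < z.re) :
    binetLogGamma (z + 1) = binetLogGamma z + Complex.log z := by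
  have h := binetFun_sub_binetFun_add_one hz
  simp only [binetLogGamma]
  linear_combination -h

theorem exp_binetLogGamma_add_nat {z : ℂ} (hz : 0 < z.re) (n : ℕ) :
    Complex.exp (binetLogGamma (z + n)) =
      (∏ j ∈ Finset.range n, (z + j)) * Complex.exp (binetLogGamma z) := by
  induction n with
  | zero => simp
  | succ n ih =>
    have hzn : 0 < (z + n).re := by simp; positivity
    have hne : z + n ≠ 0 := fun h => by simp [h] at hzn
    rw [Finset.prod_range_succ, Nat.cast_succ, ← add_assoc, binetLogGamma_add_one hzn,
      Complex.exp_add, ih, Complex.exp_log hne]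
    ring

theorem tendsto_binetFun_add_nat {z : ℂ} (hz : 0 ≤ z.re) :
    Tendsto (fun n : ℕ => binetFun (((n + 1 : ℕ) : ℂ) + z)) atTop (𝓝 0) := by
  refine squeeze_zero_norm (a := fun n : ℕ => 1 / ((n : ℝ) + 1)) (fun n => ?_)
    tendsto_one_div_add_atTop_nhds_zero_nat
  have hre : (((n + 1 : ℕ) : ℂ) + z).re = n + 1 + z.re := by simp
  have hn : (0 : ℝ) ≤ n := n.cast_nonneg
  refine (norm_binetFun_le (by rw [hre]; positivity)).trans ?_
  have h2 := (Complex.re_le_norm (((n + 1 : ℕ) : ℂ) + z))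
  rw [hre] at h2
  exact one_div_le_one_div_of_le (by positivity) (by linarith)

/-- This combination is minus the logarithm of the ratio between Euler's n-th product for Γ(z) and
its expected limit. Arguments are shifted to n + 1 because that product has n + 1 factors z, ..., z
+ n. -/
theorem tendsto_binetLogGamma_sub {z : ℂ} (hz : 0 < z.re) :
    Tendsto (fun n : ℕ => binetLogGamma (((n + 1 : ℕ) : ℂ) + z) - binetLogGamma ((n + 1 : ℕ) : ℂ)
      - z * (Real.log n : ℂ)) atTop (𝓝 0) := by
  have hμ := tendsto_binetFun_add_nat hz.le
  have hμ0 : Tendsto (fun n : ℕ => binetFun ((n + 1 : ℕ) : ℂ)) atTop (𝓝 0) := by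
    simpa using tendsto_binetFun_add_nat (z := 0) le_rfl
  have hw : Tendsto (fun n : ℕ => ((n + 1 : ℕ) : ℂ) * Complex.log (1 + z / ((n + 1 : ℕ) : ℂ)))
      atTop (𝓝 z) := by
    have : Tendsto (fun n : ℕ => (n : ℂ) * Complex.log (1 + z / (n : ℂ))) atTop (𝓝 z) := by
      refine Complex.tendsto_nat_mul_log_one_add_of_tendsto ?_
      refine tendsto_const_nhds.congr' ?_
      filter_upwards [eventually_ne_atTop 0] with n hn
      rw [mul_div_cancel₀ _ (Nat.cast_ne_zero.2 hn)]
    exact this.comp (tendsto_add_atTop_nat 1)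
  have hinv : Tendsto (fun n : ℕ => (((n + 1 : ℕ) : ℂ))⁻¹) atTop (𝓝 0) :=
    (tendsto_inv_atTop_nhds_zero_nat (𝕜 := ℂ)).comp (tendsto_add_atTop_nat 1)
  have hl : Tendsto (fun n : ℕ => Complex.log (1 + z / ((n + 1 : ℕ) : ℂ))) atTop (𝓝 0) := by
    have := hinv.mul hw
    rw [zero_mul] at this
    refine this.congr fun n => ?_
    rw [inv_mul_cancel_left₀ (Nat.cast_ne_zero.2 n.succ_ne_zero)]
  have hn : Tendsto (fun n : ℕ => ((Real.log (n + 1 : ℕ) - Real.log n : ℝ) : ℂ)) atTop (𝓝 0) := by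
    have := Real.tendsto_log_nat_add_one_sub_log
    rw [← Complex.ofReal_zero]
    refine (Complex.continuous_ofReal.tendsto 0).comp ?_
    simpa using this
  have hsum := (((hw.add (hl.const_mul (z - 1 / 2))).add (hn.const_mul z)).sub_const z).add
    (hμ.sub hμ0)
  simp only [mul_zero, add_zero, sub_self] at hsum
  refine hsum.congr fun n => ?_
  have hpos : (0 : ℝ) < (n + 1 : ℕ) := by positivity
  have hw0 : ((n + 1 : ℕ) : ℂ) ≠ 0 := Nat.cast_ne_zero.2 n.succ_ne_zero
  have hne : 1 + z / ((n + 1 : ℕ) : ℂ) ≠ 0 := by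
    intro h
    have h1 : ((n + 1 : ℕ) : ℂ) + z = 0 := by
      field_simp at h
      linear_combination h
    have := congrArg Complex.re h1
    simp at this
    have hn : (0 : ℝ) ≤ n := n.cast_nonneg
    linarith
  have hlog : Complex.log (((n + 1 : ℕ) : ℂ) + z) =
      (Real.log (n + 1 : ℕ) : ℂ) + Complex.log (1 + z / ((n + 1 : ℕ) : ℂ)) := by
    rw [← Complex.log_ofReal_mul hpos hne]
    congr 1
    rw [Complex.ofReal_natCast]
    field_simp
  have hlog0 : Complex.log ((n + 1 : ℕ) : ℂ) = (Real.log (n + 1 : ℕ) : ℂ) := by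
    rw [Complex.ofReal_log hpos.le, Complex.ofReal_natCast]
  rw [binetLogGamma, binetLogGamma, hlog, hlog0, Complex.ofReal_sub]
  ring

theorem natCast_factorial_eq_exp_binetLogGamma (n : ℕ) :
    (n.factorial : ℂ) =
      Complex.exp (binetLogGamma ((n + 1 : ℕ) : ℂ)) / Complex.exp (binetLogGamma 1) := by
  have h := exp_binetLogGamma_add_nat (z := 1) (by simp) n
  have h2 : ∏ j ∈ Finset.range n, ((1 : ℂ) + j) = (n.factorial : ℂ) := by
    rw [← Finset.prod_range_add_one_eq_factorial]
    push_cast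
    exact Finset.prod_congr rfl fun j _ => add_comm _ _
  rw [Nat.cast_succ, add_comm, h, h2, mul_div_assoc, div_self (Complex.exp_ne_zero _), mul_one]

theorem Gamma_eq_exp_binetLogGamma_div {z : ℂ} (hz : 0 < z.re) :
    Complex.Gamma z = Complex.exp (binetLogGamma z) / Complex.exp (binetLogGamma 1) := by
  refine tendsto_nhds_unique (Complex.GammaSeq_tendsto_Gamma z) ?_
  have h := ((Complex.continuous_exp.tendsto _).comp (tendsto_binetLogGamma_sub hz).neg).const_mul
    (Complex.exp (binetLogGamma z) / Complex.exp (binetLogGamma 1))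
  rw [neg_zero, Complex.exp_zero, mul_one] at h
  refine h.congr' ?_
  filter_upwards [eventually_gt_atTop 0] with n hn
  have hn0 : (n : ℂ) ≠ 0 := Nat.cast_ne_zero.2 hn.ne'
  have hp := exp_binetLogGamma_add_nat hz (n + 1)
  rw [Complex.GammaSeq, Complex.cpow_def_of_ne_zero hn0, natCast_factorial_eq_exp_binetLogGamma,
    eq_div_of_mul_eq (Complex.exp_ne_zero _) hp.symm, Function.comp]
  have hlog : Complex.log (n : ℂ) = (Real.log n : ℂ) := by
    rw [Complex.ofReal_log (Nat.cast_nonneg n), Complex.ofReal_natCast]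
  rw [hlog, show -(binetLogGamma (((n + 1 : ℕ) : ℂ) + z) - binetLogGamma ((n + 1 : ℕ) : ℂ)
      - z * (Real.log n : ℂ)) = binetLogGamma ((n + 1 : ℕ) : ℂ) + Real.log n * z -
        binetLogGamma (z + ((n + 1 : ℕ) : ℂ)) by rw [add_comm z]; ring,
    Complex.exp_sub, Complex.exp_add]
  have e1 := Complex.exp_ne_zero (binetLogGamma 1)
  have e2 := Complex.exp_ne_zero (binetLogGamma z)
  have e3 := Complex.exp_ne_zero (binetLogGamma (z + ((n + 1 : ℕ) : ℂ)))
  field_simp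

/-- Since μ(n + 1) → 0, the Stirling sequence tends to the constant over √2; its known limit √π
fixes the value. -/
theorem exp_binetLogGamma_one :
    (Complex.exp (binetLogGamma 1))⁻¹ = (Real.sqrt (2 * Real.pi) : ℂ) := by
  have h1 : Tendsto (fun n : ℕ => ((Stirling.stirlingSeq (n + 1) : ℝ) : ℂ)) atTop
      (𝓝 (Real.sqrt Real.pi : ℂ)) :=
    (Complex.continuous_ofReal.tendsto _).comp
      (Stirling.tendsto_stirlingSeq_sqrt_pi.comp (tendsto_add_atTop_nat 1))
  have hμ0 : Tendsto (fun n : ℕ => binetFun ((n + 1 : ℕ) : ℂ)) atTop (𝓝 0) := by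
    simpa using tendsto_binetFun_add_nat (z := 0) le_rfl
  have h2 := ((Complex.continuous_exp.tendsto _).comp hμ0).const_mul
    ((Complex.exp (binetLogGamma 1))⁻¹ / (Real.sqrt 2 : ℂ))
  rw [Complex.exp_zero, mul_one] at h2
  have h3 : (Real.sqrt Real.pi : ℂ) = (Complex.exp (binetLogGamma 1))⁻¹ / (Real.sqrt 2 : ℂ) := by
    refine tendsto_nhds_unique h1 (h2.congr fun n => ?_)
    have hpos : (0 : ℝ) < (n + 1 : ℕ) := by positivity
    have hre : 0 < (((n + 1 : ℕ) : ℂ)).re := by rw [Complex.natCast_re]; exact hpos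
    have hne : ((n + 1 : ℕ) : ℂ) ≠ 0 := Nat.cast_ne_zero.2 n.succ_ne_zero
    have hlog0 : Complex.log ((n + 1 : ℕ) : ℂ) = (Real.log (n + 1 : ℕ) : ℂ) := by
      rw [Complex.ofReal_log hpos.le, Complex.ofReal_natCast]
    rw [Stirling.stirlingSeq, Complex.ofReal_div, Complex.ofReal_natCast,
      natCast_factorial_eq_exp_binetLogGamma, Nat.cast_succ (n + 1), binetLogGamma_add_one hre]
    have hden : Real.sqrt (2 * (n + 1 : ℕ)) * (((n + 1 : ℕ) : ℝ) / Real.exp 1) ^ (n + 1) =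
        Real.sqrt 2 * Real.exp (Real.log (n + 1 : ℕ) / 2 +
          ((n + 1 : ℕ) * Real.log (n + 1 : ℕ) - (n + 1 : ℕ))) := by
      rw [Real.sqrt_mul (by norm_num), Real.exp_add, mul_assoc, Real.exp_half, Real.exp_log hpos,
        Real.exp_sub, mul_comm ((n + 1 : ℕ) : ℝ) (Real.log _), Real.exp_mul, Real.exp_log hpos,
        Real.rpow_natCast, div_pow, ← Real.exp_nat_mul, mul_one]
    rw [hden, show binetLogGamma ((n + 1 : ℕ) : ℂ) = (((n + 1 : ℕ) : ℂ) - 1 / 2) *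
      Complex.log ((n + 1 : ℕ) : ℂ) - ((n + 1 : ℕ) : ℂ) + binetFun ((n + 1 : ℕ) : ℂ) from rfl,
      hlog0]
    have e1 : (Real.sqrt 2 : ℂ) ≠ 0 := by
      rw [Complex.ofReal_ne_zero]; positivity
    have e2 := Complex.exp_ne_zero (binetLogGamma 1)
    rw [Complex.ofReal_mul, Complex.ofReal_exp, Function.comp]
    set ℓ := Real.log (n + 1 : ℕ)
    have e3 : (((n + 1 : ℕ) : ℂ) - 1 / 2) * ℓ - ((n + 1 : ℕ) : ℂ) + binetFun ((n + 1 : ℕ) : ℂ) + ℓ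
        = ((ℓ / 2 + ((n + 1 : ℕ) * ℓ - (n + 1 : ℕ)) : ℝ) : ℂ) + binetFun ((n + 1 : ℕ) : ℂ) := by
      push_cast; ring
    rw [e3, Complex.exp_add]
    have e4 := Complex.exp_ne_zero ((ℓ / 2 + ((n + 1 : ℕ) * ℓ - (n + 1 : ℕ)) : ℝ) : ℂ)
    field_simp
  have e1 : (Real.sqrt 2 : ℂ) ≠ 0 := by
    rw [Complex.ofReal_ne_zero]; positivity
  rw [Real.sqrt_mul (by norm_num), Complex.ofReal_mul, h3]
  field_simp

/-- **Binet's first formula** in the right half plane. -/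
theorem Gamma_eq_exp_binetLogGamma {z : ℂ} (hz : 0 < z.re) :
    Complex.Gamma z = (Real.sqrt (2 * Real.pi) : ℂ) * Complex.exp (binetLogGamma z) := by
  rw [Gamma_eq_exp_binetLogGamma_div hz, ← exp_binetLogGamma_one, div_eq_inv_mul]

/-- **Binet's first formula** on the imaginary axis. -/
theorem Gamma_I_mul_eq_exp_binetLogGamma {τ : ℝ} (hτ : 0 < τ) :
    Complex.Gamma (Complex.I * τ) =
      (Real.sqrt (2 * Real.pi) : ℂ) * Complex.exp (binetLogGamma (Complex.I * τ)) := by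
  have hne : Complex.I * (τ : ℂ) ≠ 0 :=
    mul_ne_zero Complex.I_ne_zero (Complex.ofReal_ne_zero.2 hτ.ne')
  have him : (Complex.I * (τ : ℂ)).im = τ := by simp
  -- Approach iτ from the open half plane: both sides are continuous there relative to the closed
  -- half plane, so the identity passes to the limit.
  have hpath : Tendsto (fun ε : ℝ => (ε : ℂ) + Complex.I * τ) (𝓝[>] 0)
      (𝓝[{w | 0 ≤ w.re}] (Complex.I * τ)) := by
    refine tendsto_nhdsWithin_iff.2 ⟨?_, ?_⟩
    · have : Continuous fun ε : ℝ => (ε : ℂ) + Complex.I * τ := by fun_prop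
      have h := this.tendsto 0
      rw [Complex.ofReal_zero, zero_add] at h
      exact h.mono_left nhdsWithin_le_nhds
    · filter_upwards [self_mem_nhdsWithin] with ε hε
      simpa using le_of_lt hε
  have hG : ContinuousAt Complex.Gamma (Complex.I * τ) := by
    refine (Complex.differentiableAt_Gamma _ fun m h => ?_).continuousAt
    have := congrArg Complex.im h
    rw [him] at this
    simp at this
    exact hτ.ne' this
  have hL : ContinuousWithinAt (fun z => (Real.sqrt (2 * Real.pi) : ℂ) *
      Complex.exp (binetLogGamma z)) {w | 0 ≤ w.re} (Complex.I * τ) := by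
    refine continuousWithinAt_const.mul (ContinuousWithinAt.cexp ?_)
    refine ContinuousWithinAt.add ?_ (continuousWithinAt_binetFun hne)
    have hs : Complex.I * (τ : ℂ) ∈ Complex.slitPlane := Or.inr (by rw [him]; exact hτ.ne')
    refine ContinuousAt.continuousWithinAt ?_
    exact ((continuousAt_id.sub continuousAt_const).mul (continuousAt_id.clog hs)).sub
      continuousAt_id
  refine tendsto_nhds_unique (hG.continuousWithinAt.tendsto.comp hpath) ?_
  refine (hL.tendsto.comp hpath).congr' ?_
  filter_upwards [self_mem_nhdsWithin] with ε hε
  exact (Gamma_eq_exp_binetLogGamma (by simpa using hε)).symm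

/-! ### The Stirling remainder and the polar form of Γ(iτ). -/

theorem binetIntegrand_of_pos (τ : ℝ) {t : ℝ} (ht : 0 < t) :
    binetIntegrand τ t = Complex.exp (-(Complex.I * τ * t)) * (binetKernel t : ℂ) := by
  rw [binetIntegrand, binetKernel_of_pos ht]

theorem intervalIntegrable_binetIntegrand (τ : ℝ) {T : ℝ} (hT : 0 < T) :
    IntervalIntegrable (binetIntegrand τ) volume 0 T := by
  have h : IntervalIntegrable (fun t : ℝ => Complex.exp (-(Complex.I * τ * t)) *
      (binetKernel t : ℂ)) volume 0 T := by
    refine ContinuousOn.intervalIntegrable (ContinuousOn.mul (by fun_prop) ?_)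
    rw [Set.uIcc_of_le hT.le]
    exact Complex.continuous_ofReal.comp_continuousOn
      (continuousOn_binetKernel.mono Set.Icc_subset_Ici_self)
  refine h.congr fun t ht => ?_
  rw [Set.uIoc_of_le hT.le] at ht
  exact (binetIntegrand_of_pos τ ht.1).symm

theorem tendsto_integral_binetIntegrand {τ : ℝ} (hτ : 0 < τ) :
    Tendsto (fun T : ℝ => ∫ t in (0 : ℝ)..T, binetIntegrand τ t) atTop
      (𝓝 (binetFun (Complex.I * τ))) := by
  have hne : Complex.I * (τ : ℂ) ≠ 0 :=
    mul_ne_zero Complex.I_ne_zero (Complex.ofReal_ne_zero.2 hτ.ne')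
  refine (tendsto_integral_exp_mul_binetKernel (by simp) hne).congr' ?_
  filter_upwards [eventually_gt_atTop 0] with T hT
  rw [intervalIntegral.integral_of_le hT.le, intervalIntegral.integral_of_le hT.le]
  exact setIntegral_congr_fun measurableSet_Ioc fun t ht => (binetIntegrand_of_pos τ ht.1).symm

theorem binetIntegral_eq_binetFun {τ : ℝ} (hτ : 0 < τ) :
    binetIntegral τ = binetFun (Complex.I * τ) :=
  (tendsto_integral_binetIntegrand hτ).limUnder_eq

theorem norm_stirlingRemainder_le {τ₀ τ : ℝ} (h₀ : 0 < τ₀) (hτ : τ₀ ≤ τ) :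
    ‖stirlingRemainder τ‖ ≤ Real.exp (1 / (6 * τ₀)) / (6 * τ) := by
  have hτ0 : 0 < τ := h₀.trans_le hτ
  rw [stirlingRemainder, binetIntegral_eq_binetFun hτ0]
  have h1 : ‖binetFun (Complex.I * τ)‖ ≤ 1 / (6 * τ) := by
    have := norm_binetFun_le (z := Complex.I * τ) (by simp)
    rwa [norm_mul, Complex.norm_I, one_mul, Complex.norm_real, Real.norm_of_nonneg hτ0.le] at this
  have h2 := Complex.norm_exp_sub_sum_le_norm_mul_exp (binetFun (Complex.I * τ)) 1
  simp only [Finset.sum_range_one, pow_zero, Nat.factorial_zero, Nat.cast_one, div_one,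
    pow_one] at h2
  have h3 : 1 / (6 * τ) ≤ 1 / (6 * τ₀) := by gcongr
  calc _ ≤ _ := h2
    _ ≤ 1 / (6 * τ) * Real.exp (1 / (6 * τ₀)) := by
      gcongr
      exact h1.trans h3
    _ = _ := by ring

/-- Substitute log(iτ) = log τ + iπ/2 in (iτ - 1/2) log(iτ) - iτ and separate real and imaginary
parts. -/
theorem Gamma_I_mul_eq {τ : ℝ} (hτ : 0 < τ) :
    Complex.Gamma (Complex.I * τ) =
      ((Real.sqrt (2 * Real.pi / τ) * Real.exp (-(Real.pi * τ / 2)) : ℝ) : ℂ) *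
        Complex.exp (Complex.I * ((τ * Real.log τ - τ - Real.pi / 4 : ℝ) : ℂ)) *
        (1 + stirlingRemainder τ) := by
  have hlog : Complex.log (Complex.I * τ) = (Real.log τ : ℂ) + Real.pi / 2 * Complex.I := by
    rw [mul_comm, Complex.log_ofReal_mul hτ Complex.I_ne_zero, Complex.log_I]
  have hsq : Real.sqrt (2 * Real.pi / τ) =
      Real.sqrt (2 * Real.pi) * Real.exp (-(Real.log τ / 2)) := by
    rw [Real.sqrt_div (by positivity), Real.exp_neg, Real.exp_half, Real.exp_log hτ, div_eq_mul_inv]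
  rw [Gamma_I_mul_eq_exp_binetLogGamma hτ, hsq, stirlingRemainder, binetIntegral_eq_binetFun hτ,
    binetLogGamma, hlog, Complex.exp_add, add_sub_cancel, ← mul_assoc]
  congr 1
  rw [mul_assoc (Real.sqrt _), ← Real.exp_add, Complex.ofReal_mul, Complex.ofReal_exp, mul_assoc,
    ← Complex.exp_add]
  congr 2
  push_cast
  linear_combination (Real.pi / 2 * (τ : ℂ)) * Complex.I_sq

/-! ### The Macdonald function of imaginary order as a real part. -/

theorem Gamma_add_natCast {s : ℂ} (hs : ∀ m : ℕ, s ≠ -m) (n : ℕ) :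
    Complex.Gamma (s + n) = (ascPochhammer ℂ n).eval s * Complex.Gamma s := by
  induction n with
  | zero => simp
  | succ n ih =>
    have hne : s + n ≠ 0 := fun h => hs n (eq_neg_of_add_eq_zero_left h)
    rw [Nat.cast_succ, ← add_assoc, Complex.Gamma_add_one _ hne, ih, ascPochhammer_succ_eval]
    ring

/-- The series `∑ (x/2)^{2k} / (k! (1 - iτ)_k)`. -/
noncomputable def besselSeries (x τ : ℝ) : ℂ :=
  ∑' k : ℕ, ((x : ℂ) / 2) ^ (2 * k) / ((k.factorial : ℂ) * pochOneSub τ k)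

theorem one_sub_I_mul_ne_neg_nat (τ : ℝ) (m : ℕ) : 1 - Complex.I * (τ : ℂ) ≠ -(m : ℂ) := by
  intro h
  have := congrArg Complex.re h
  simp at this
  have hm : (0 : ℝ) ≤ m := m.cast_nonneg
  linarith

theorem besselI_neg_I_mul {x : ℝ} (hx : 0 < x) (τ : ℝ) :
    besselI (-(Complex.I * τ)) x =
      ((x : ℂ) / 2) ^ (-(Complex.I * (τ : ℂ))) / Complex.Gamma (1 - Complex.I * τ) *
        besselSeries x τ := by
  rw [besselI, besselSeries, ← tsum_mul_left]
  refine tsum_congr fun k => ?_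
  have hx0 : (x : ℂ) / 2 ≠ 0 := div_ne_zero (Complex.ofReal_ne_zero.2 hx.ne') two_ne_zero
  rw [Complex.cpow_add _ _ hx0, show (2 * (k : ℂ)) = ((2 * k : ℕ) : ℂ) by push_cast; ring,
    Complex.cpow_natCast, show (k : ℂ) + -(Complex.I * τ) + 1 = (1 - Complex.I * τ) + k by ring,
    Gamma_add_natCast (one_sub_I_mul_ne_neg_nat τ), pochOneSub, div_mul_div_comm]
  ring

theorem besselI_conj {x : ℝ} (hx : 0 < x) (ν : ℂ) :
    besselI (starRingEnd ℂ ν) x = starRingEnd ℂ (besselI ν x) := by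
  rw [besselI, besselI, Complex.conj_tsum]
  refine tsum_congr fun k => ?_
  have harg : ((x : ℂ) / 2).arg ≠ Real.pi := by
    rw [show (x : ℂ) / 2 = ((x / 2 : ℝ) : ℂ) by push_cast; ring,
      Complex.arg_ofReal_of_nonneg (by positivity)]
    exact Real.pi_pos.ne
  rw [map_div₀, map_mul, ← Complex.Gamma_conj, Complex.conj_natCast]
  have h2 : starRingEnd ℂ ((x : ℂ) / 2) = (x : ℂ) / 2 := by
    rw [map_div₀, Complex.conj_ofReal, Complex.conj_ofNat]
  have h3 : starRingEnd ℂ (2 * (k : ℂ) + ν) = 2 * (k : ℂ) + starRingEnd ℂ ν := by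
    rw [map_add, map_mul, Complex.conj_natCast, Complex.conj_ofNat]
  rw [← h3, Complex.cpow_conj _ _ harg, h2, map_add, map_add, Complex.conj_natCast, map_one]

theorem sin_I_mul_pi (τ : ℝ) :
    Complex.sin (Complex.I * τ * Real.pi) = (Real.sinh (Real.pi * τ) : ℂ) * Complex.I := by
  rw [show Complex.I * (τ : ℂ) * Real.pi = ((Real.pi * τ : ℝ) : ℂ) * Complex.I by push_cast; ring,
    Complex.sin_mul_I, Complex.ofReal_sinh]

/-- By conjugation symmetry the numerator is 2i times an imaginary part, and reflection replaces
1/Γ(1 - iτ) by i sinh(πτ) Γ(iτ)/π, which cancels the sine. -/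
theorem besselK_I_mul {x τ : ℝ} (hx : 0 < x) (hτ : 0 < τ) :
    besselK (Complex.I * τ) x =
      ((((x : ℂ) / 2) ^ (-(Complex.I * (τ : ℂ))) * Complex.Gamma (Complex.I * τ) *
        besselSeries x τ).re : ℂ) := by
  have hsh : (0 : ℝ) < Real.sinh (Real.pi * τ) := Real.sinh_pos_iff.2 (by positivity)
  have hshC : (Real.sinh (Real.pi * τ) : ℂ) ≠ 0 := Complex.ofReal_ne_zero.2 hsh.ne'
  have hsin : Complex.sin (Complex.I * τ * Real.pi) ≠ 0 := by
    rw [sin_I_mul_pi]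
    exact mul_ne_zero hshC Complex.I_ne_zero
  have hpi : (Real.pi : ℂ) ≠ 0 := Complex.ofReal_ne_zero.2 Real.pi_pos.ne'
  rw [besselK, if_neg hsin, besselKQuot, sin_I_mul_pi]
  have hconj : besselI (Complex.I * τ) x = starRingEnd ℂ (besselI (-(Complex.I * τ)) x) := by
    rw [← besselI_conj hx]
    congr 1
    simp
  have hrefl := Complex.Gamma_mul_Gamma_one_sub (Complex.I * τ)
  rw [mul_comm (Real.pi : ℂ), sin_I_mul_pi] at hrefl
  have hG : Complex.Gamma (1 - Complex.I * τ) ≠ 0 :=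
    Complex.Gamma_ne_zero (one_sub_I_mul_ne_neg_nat τ)
  set g := ((x : ℂ) / 2) ^ (-(Complex.I * (τ : ℂ))) * Complex.Gamma (Complex.I * τ) *
        besselSeries x τ with hg
  have hw : besselI (-(Complex.I * τ)) x =
      ((Real.sinh (Real.pi * τ) / Real.pi : ℝ) : ℂ) * Complex.I * g := by
    rw [besselI_neg_I_mul hx, hg]
    rw [eq_div_iff (mul_ne_zero hshC Complex.I_ne_zero)] at hrefl
    rw [Complex.ofReal_div]
    field_simp
    linear_combination (-(((x : ℂ) / 2) ^ (-(Complex.I * (τ : ℂ))) * besselSeries x τ)) * hrefl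
  rw [hconj, hw, Complex.re_eq_add_conj]
  rw [map_mul, map_mul, Complex.conj_ofReal, Complex.conj_I, Complex.ofReal_div]
  field_simp
  ring

theorem besselK_I_mul_eq {x τ : ℝ} (hx : 0 < x) (hτ : 0 < τ) :
    besselK (Complex.I * τ) x =
      ((Real.sqrt (2 * Real.pi / τ) * Real.exp (-(Real.pi * τ / 2)) *
        (Complex.exp (Complex.I * (phase x τ : ℂ)) *
          ((1 + stirlingRemainder τ) * besselSeries x τ)).re : ℝ) : ℂ) := by
  rw [besselK_I_mul hx hτ, Gamma_I_mul_eq hτ]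
  have hpow : ((x : ℂ) / 2) ^ (-(Complex.I * (τ : ℂ))) =
      Complex.exp (Complex.I * ((-(τ * Real.log (x / 2)) : ℝ) : ℂ)) := by
    have hx0 : (x : ℂ) / 2 ≠ 0 := div_ne_zero (Complex.ofReal_ne_zero.2 hx.ne') two_ne_zero
    have hlog : Complex.log ((x : ℂ) / 2) = (Real.log (x / 2) : ℂ) := by
      rw [Complex.ofReal_log (by positivity)]; push_cast; rfl
    rw [Complex.cpow_def_of_ne_zero hx0, hlog]
    congr 1
    push_cast
    ring
  have hphase : phase x τ = -(τ * Real.log (x / 2)) + (τ * Real.log τ - τ - Real.pi / 4) := by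
    rw [phase, Real.log_div (by positivity) (by positivity), Real.log_mul (by norm_num) hτ.ne',
      Real.log_mul (Real.exp_pos 1).ne' hx.ne', Real.log_exp, Real.log_div hx.ne' (by norm_num)]
    ring
  have hexp : Complex.exp (Complex.I * (phase x τ : ℂ)) =
      Complex.exp (Complex.I * ((-(τ * Real.log (x / 2)) : ℝ) : ℂ)) *
      Complex.exp (Complex.I * ((τ * Real.log τ - τ - Real.pi / 4 : ℝ) : ℂ)) := by
    rw [hphase, ← Complex.exp_add, Complex.ofReal_add, mul_add]
  rw [hpow, hexp, ← Complex.re_ofReal_mul]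
  congr 2
  ring

/-! ### Beta-type integrals. -/

theorem norm_ofReal_cpow_le {a b : ℝ} (ha : 0 < a) (hab : a ≤ b) {c : ℂ} (hc : 0 ≤ c.re) :
    ‖(a : ℂ) ^ c‖ ≤ b ^ c.re := by
  rw [Complex.norm_cpow_eq_rpow_re_of_pos ha]
  exact Real.rpow_le_rpow ha.le hab hc

theorem sq_sub_sq_pos {x y : ℝ} (hy : y ∈ Set.Ioo 0 x) : 0 < x ^ 2 - y ^ 2 := by
  have := hy.1
  have := hy.2
  nlinarith

/-- When re c = 0 the power may oscillate as y → x, so only boundedness and continuity on the open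
interval are used. -/
theorem intervalIntegrable_sq_sub_sq_cpow {x : ℝ} (hx : 0 < x) {c : ℂ} (hc : 0 ≤ c.re) :
    IntervalIntegrable (fun y : ℝ => ((x ^ 2 - y ^ 2 : ℝ) : ℂ) ^ c) volume 0 x := by
  rw [intervalIntegrable_iff_integrableOn_Ioo_of_le hx.le]
  refine Integrable.mono' (g := fun _ => (x ^ 2) ^ c.re) (integrableOn_const (by simp)) ?_ ?_
  · refine ContinuousOn.aestronglyMeasurable (fun y hy => ?_) measurableSet_Ioo
    have h := Complex.continuousAt_ofReal_cpow_const (x ^ 2 - y ^ 2) c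
      (Or.inr (sq_sub_sq_pos hy).ne')
    exact (ContinuousAt.comp (f := fun y : ℝ => x ^ 2 - y ^ 2) h
      (by fun_prop)).continuousWithinAt
  · filter_upwards [ae_restrict_mem measurableSet_Ioo] with y hy
    exact norm_ofReal_cpow_le (sq_sub_sq_pos hy) (by nlinarith [sq_nonneg y]) hc

theorem continuous_sq_sub_sq_cpow (x : ℝ) {c : ℂ} (hc : 0 ≤ c.re) :
    Continuous (fun y : ℝ => ((x ^ 2 - y ^ 2 : ℝ) : ℂ) ^ (c + 1)) := by
  have hc1 : 0 < (c + 1).re := by simp; linarith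
  exact (Complex.continuous_ofReal_cpow_const hc1).comp (by fun_prop)

theorem hasDerivAt_sq_sub_sq_cpow {x y : ℝ} (hy : y ∈ Set.Ioo 0 x) {c : ℂ} (hc : 0 ≤ c.re) :
    HasDerivAt (fun y : ℝ => ((x ^ 2 - y ^ 2 : ℝ) : ℂ) ^ (c + 1))
      (-(2 * (c + 1) * (((x ^ 2 - y ^ 2 : ℝ) : ℂ) ^ c * y))) y := by
  have hc1 : c + 1 ≠ 0 := fun h => by
    have := congrArg Complex.re h
    simp at this
    linarith
  have h1 := hasDerivAt_ofReal_cpow_const (sq_sub_sq_pos hy).ne' hc1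
  have h2 : HasDerivAt (fun y : ℝ => x ^ 2 - y ^ 2) (-(2 * y)) y := by
    simpa using (hasDerivAt_pow 2 y).const_sub (x ^ 2)
  refine (HasDerivAt.scomp y h1 h2).congr_deriv ?_
  rw [add_sub_cancel_right, Complex.real_smul]
  push_cast
  ring

/-- A Beta integral in the variable y². Integrating by parts lowers j and raises c by one, so the
induction runs over all c. -/
theorem integral_sq_sub_sq_cpow_mul_pow {x : ℝ} (hx : 0 < x) (j : ℕ) {c : ℂ} (hc : 0 ≤ c.re) :
    ∫ y in (0 : ℝ)..x, ((x ^ 2 - y ^ 2 : ℝ) : ℂ) ^ c * (y : ℂ) ^ (2 * j + 1) =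
      ((x ^ 2 : ℝ) : ℂ) ^ (c + j + 1) * (j.factorial : ℂ) /
        (2 * (ascPochhammer ℂ (j + 1)).eval (c + 1)) := by
  have hne : ∀ {c : ℂ}, 0 ≤ c.re → c + 1 ≠ 0 := fun {c} hc h => by
    have := congrArg Complex.re h
    simp at this
    linarith
  have hint : ∀ {c : ℂ}, 0 ≤ c.re → ∀ k : ℕ, IntervalIntegrable
      (fun y : ℝ => ((x ^ 2 - y ^ 2 : ℝ) : ℂ) ^ c * (y : ℂ) ^ k) volume 0 x := fun hc k =>
    (intervalIntegrable_sq_sub_sq_cpow hx hc).mul_continuousOn (by fun_prop)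
  induction j generalizing c with
  | zero =>
    have h := intervalIntegral.integral_eq_sub_of_hasDerivAt_of_le hx.le
      (continuous_sq_sub_sq_cpow x hc).continuousOn
      (fun y hy => hasDerivAt_sq_sub_sq_cpow hy hc)
      (by
        have h1 := ((hint hc 1).const_mul (2 * (c + 1))).neg
        simp only [pow_one] at h1
        exact h1)
    rw [intervalIntegral.integral_neg, intervalIntegral.integral_const_mul, sub_self,
      Complex.ofReal_zero, Complex.zero_cpow (hne hc)] at h
    have hc1 := hne hc
    simp only [mul_zero, zero_add, pow_one, Nat.cast_zero, add_zero, Nat.factorial_zero,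
      Nat.cast_one, mul_one, ascPochhammer_one, Polynomial.eval_X]
    rw [eq_div_iff (by simpa using hc1)]
    norm_num at h
    push_cast
    linear_combination h
  | succ j ih =>
    have hc1 : 0 ≤ (c + 1).re := by simp; linarith
    -- This primitive vanishes at both endpoints, so integrating its derivative gives the recursion
    -- between the two integrals.
    have hd : ∀ y ∈ Set.Ioo 0 x, HasDerivAt
        (fun y : ℝ => ((x ^ 2 - y ^ 2 : ℝ) : ℂ) ^ (c + 1) * (y : ℂ) ^ (2 * j + 2))
        ((2 * (j + 1)) * (((x ^ 2 - y ^ 2 : ℝ) : ℂ) ^ (c + 1) * (y : ℂ) ^ (2 * j + 1)) -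
          2 * (c + 1) * (((x ^ 2 - y ^ 2 : ℝ) : ℂ) ^ c * (y : ℂ) ^ (2 * (j + 1) + 1))) y := by
      intro y hy
      have h0 : HasDerivAt (fun u : ℝ => (u : ℂ)) 1 y := Complex.ofRealCLM.hasDerivAt
      refine ((hasDerivAt_sq_sub_sq_cpow hy hc).mul (h0.pow (2 * j + 2))).congr_deriv ?_
      rw [show 2 * j + 2 - 1 = 2 * j + 1 by omega]
      simp only [Pi.pow_apply]
      push_cast
      ring
    have h := intervalIntegral.integral_eq_sub_of_hasDerivAt_of_le hx.le
      ((continuous_sq_sub_sq_cpow x hc).mul (by fun_prop)).continuousOn hd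
      (((hint hc1 _).const_mul _).sub ((hint hc _).const_mul _))
    simp only [Pi.mul_apply] at h
    rw [intervalIntegral.integral_sub ((hint hc1 _).const_mul _) ((hint hc _).const_mul _),
      intervalIntegral.integral_const_mul, intervalIntegral.integral_const_mul, ih hc1, sub_self,
      Complex.ofReal_zero, Complex.zero_cpow (hne hc), zero_pow (show 2 * j + 2 ≠ 0 by omega), mul_zero, zero_mul,
      sub_zero] at h
    have hP : (ascPochhammer ℂ (j + 1 + 1)).eval (c + 1) =
        (c + 1) * (ascPochhammer ℂ (j + 1)).eval (c + 1 + 1) := by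
      rw [ascPochhammer_succ_left]
      simp
    have hP0 : (ascPochhammer ℂ (j + 1)).eval (c + 1 + 1) ≠ 0 := by
      intro h0
      obtain ⟨k, -, hk⟩ := (ascPochhammer_eval_eq_zero_iff _ _).1 h0
      have := congrArg Complex.re hk
      simp at this
      have hk0 : (0 : ℝ) ≤ k := k.cast_nonneg
      linarith
    have hc1' := hne hc
    rw [hP, Nat.factorial_succ, show c + ((j + 1 : ℕ) : ℂ) + 1 = c + 1 + j + 1 by push_cast; ring,
      eq_div_iff (mul_ne_zero two_ne_zero (mul_ne_zero hc1' hP0))]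
    rw [sub_eq_zero] at h
    field_simp at h
    rw [Nat.cast_mul, Nat.cast_succ]
    linear_combination -h

/-! ### The series and the integral form of its tail. -/

theorem pochOneSub_succ (τ : ℝ) (m : ℕ) :
    pochOneSub τ (m + 1) = pochOneSub τ m * (1 - Complex.I * τ + m) :=
  ascPochhammer_succ_eval _ _

/-- Every factor 1 - iτ + k has imaginary part -τ. -/
theorem pow_le_norm_pochOneSub {τ : ℝ} (hτ : 0 ≤ τ) (m : ℕ) : τ ^ m ≤ ‖pochOneSub τ m‖ := by
  induction m with
  | zero => simp [pochOneSub]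
  | succ m ih =>
    rw [pochOneSub_succ, norm_mul, pow_succ]
    refine mul_le_mul ih ?_ hτ (norm_nonneg _)
    have := Complex.abs_im_le_norm (1 - Complex.I * (τ : ℂ) + m)
    simpa [abs_of_nonneg hτ] using this

theorem pochOneSub_ne_zero {τ : ℝ} (hτ : 0 < τ) (m : ℕ) : pochOneSub τ m ≠ 0 := by
  rw [← norm_pos_iff]
  exact (pow_pos hτ m).trans_le (pow_le_norm_pochOneSub hτ.le m)

theorem pochOneSub_add (τ : ℝ) (n m : ℕ) :
    pochOneSub τ (n + m) =
      pochOneSub τ n * (ascPochhammer ℂ m).eval (1 - Complex.I * τ + n) := by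
  rw [pochOneSub, ← ascPochhammer_mul, Polynomial.eval_mul]
  simp [pochOneSub]

theorem norm_besselSeries_term_le {x τ : ℝ} (hτ : 0 < τ) (k : ℕ) :
    ‖((x : ℂ) / 2) ^ (2 * k) / ((k.factorial : ℂ) * pochOneSub τ k)‖ ≤
      (x ^ 2 / (4 * τ)) ^ k / k.factorial := by
  have hk : (0 : ℝ) < k.factorial := by exact_mod_cast k.factorial_pos
  have h := pow_le_norm_pochOneSub hτ.le k
  have hp : 0 < τ ^ k := pow_pos hτ k
  rw [norm_div, norm_mul, norm_pow, norm_div, Complex.norm_real, Complex.norm_natCast, pow_mul,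
    div_pow, Real.norm_eq_abs, sq_abs, Complex.norm_ofNat]
  calc _ ≤ (x ^ 2 / 2 ^ 2) ^ k / (k.factorial * τ ^ k) := by gcongr
    _ = _ := by
      rw [div_pow, div_pow, mul_pow]
      field_simp
      norm_num

theorem summable_besselSeries (x : ℝ) {τ : ℝ} (hτ : 0 < τ) :
    Summable fun k : ℕ => ((x : ℂ) / 2) ^ (2 * k) / ((k.factorial : ℂ) * pochOneSub τ k) :=
  Summable.of_norm_bounded (Real.summable_pow_div_factorial _)
    fun k => norm_besselSeries_term_le hτ k

/-- The coefficient of `y^{2j+1}` in `I_{N+1}(y) / y^N`. -/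
noncomputable def besselCoeff (N j : ℕ) : ℝ :=
  1 / (2 ^ (2 * j + N + 1) * (j.factorial * (j + N + 1).factorial))

theorem besselCoeff_nonneg (N j : ℕ) : 0 ≤ besselCoeff N j := by
  rw [besselCoeff]; positivity

theorem besselCoeff_le (N j : ℕ) : besselCoeff N j ≤ 1 / j.factorial := by
  have h1 : (1 : ℝ) ≤ 2 ^ (2 * j + N + 1) := one_le_pow₀ (by norm_num)
  have h2 : (1 : ℝ) ≤ (j + N + 1).factorial := by exact_mod_cast (j + N + 1).factorial_pos
  have hj : (0 : ℝ) < j.factorial := by exact_mod_cast j.factorial_pos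
  refine one_div_le_one_div_of_le hj ?_
  nlinarith [mul_le_mul_of_nonneg_left h2 hj.le, mul_le_mul h1 h2 zero_le_one (by positivity)]

theorem norm_besselCoeff_mul_pow_le (N j : ℕ) {x y : ℝ} (hy : 0 ≤ y) (hyx : y ≤ x) :
    ‖(besselCoeff N j : ℂ) * (y : ℂ) ^ (2 * j + 1)‖ ≤ (x ^ 2) ^ j / j.factorial * x := by
  rw [norm_mul, norm_pow, Complex.norm_real, Complex.norm_real,
    Real.norm_of_nonneg (besselCoeff_nonneg N j), Real.norm_of_nonneg hy]
  calc _ ≤ 1 / (j.factorial : ℝ) * x ^ (2 * j + 1) := by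
        gcongr
        exact besselCoeff_le N j
    _ = _ := by rw [pow_succ, pow_mul]; ring

theorem summable_sq_pow_div_factorial_mul (x : ℝ) :
    Summable fun j : ℕ => (x ^ 2) ^ j / j.factorial * x :=
  (Real.summable_pow_div_factorial _).mul_right x

theorem hasSum_besselI_div_pow (N : ℕ) {y : ℝ} (hy : 0 < y) :
    HasSum (fun j : ℕ => (besselCoeff N j : ℂ) * (y : ℂ) ^ (2 * j + 1))
      (besselI ((N : ℂ) + 1) y / (y : ℂ) ^ N) := by
  have hs : Summable (fun j : ℕ => (besselCoeff N j : ℂ) * (y : ℂ) ^ (2 * j + 1)) :=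
    Summable.of_norm_bounded (summable_sq_pow_div_factorial_mul y)
      fun j => norm_besselCoeff_mul_pow_le N j hy.le le_rfl
  have hy0 : (y : ℂ) ≠ 0 := Complex.ofReal_ne_zero.2 hy.ne'
  convert hs.hasSum using 1
  rw [besselI, ← tsum_div_const]
  refine tsum_congr fun j => ?_
  rw [show (2 * (j : ℂ) + ((N : ℂ) + 1)) = ((2 * j + 1 + N : ℕ) : ℂ) by push_cast; ring,
    show (j : ℂ) + ((N : ℂ) + 1) + 1 = ((j + N + 1 : ℕ) : ℂ) + 1 by push_cast; ring,
    Complex.cpow_natCast, Complex.Gamma_nat_eq_factorial, besselCoeff, div_pow,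
    pow_add (y : ℂ) (2 * j + 1) N, show 2 * j + N + 1 = 2 * j + 1 + N by ring]
  push_cast
  field_simp

theorem continuousOn_tsum_besselCoeff (N : ℕ) (x : ℝ) :
    ContinuousOn (fun y : ℝ => ∑' j : ℕ, (besselCoeff N j : ℂ) * (y : ℂ) ^ (2 * j + 1))
      (Set.Icc 0 x) :=
  continuousOn_tsum (fun j => by fun_prop) (summable_sq_pow_div_factorial_mul x)
    fun j _ hy => norm_besselCoeff_mul_pow_le N j hy.1 hy.2

theorem zero_le_re_natCast_sub_I_mul (N : ℕ) (τ : ℝ) :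
    0 ≤ ((N : ℂ) - Complex.I * τ).re := by simp

theorem intervalIntegrable_remainderIntegrand (N : ℕ) {x : ℝ} (hx : 0 < x) (τ : ℝ) :
    IntervalIntegrable (remainderIntegrand N x τ) volume 0 x := by
  have h := (intervalIntegrable_sq_sub_sq_cpow hx
    (zero_le_re_natCast_sub_I_mul N τ)).mul_continuousOn
    (g := fun y : ℝ => ∑' j : ℕ, (besselCoeff N j : ℂ) * (y : ℂ) ^ (2 * j + 1))
    (by rw [Set.uIcc_of_le hx.le]; exact continuousOn_tsum_besselCoeff N x)
  refine h.congr fun y hy => ?_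
  rw [Set.uIoc_of_le hx.le] at hy
  simp only [remainderIntegrand]
  rw [(hasSum_besselI_div_pow N hy.1).tsum_eq, mul_div_assoc]

theorem hasSum_integral_remainderIntegrand (N : ℕ) {x : ℝ} (hx : 0 < x) (τ : ℝ) :
    HasSum (fun j : ℕ => (besselCoeff N j : ℂ) *
        (((x ^ 2 : ℝ) : ℂ) ^ ((N : ℂ) - Complex.I * τ + j + 1) * (j.factorial : ℂ) /
        (2 * (ascPochhammer ℂ (j + 1)).eval ((N : ℂ) - Complex.I * τ + 1))))
      (∫ y in (0 : ℝ)..x, remainderIntegrand N x τ y) := by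
  set c : ℂ := (N : ℂ) - Complex.I * τ with hcdef
  have hc : 0 ≤ c.re := zero_le_re_natCast_sub_I_mul N τ
  have hint := intervalIntegrable_sq_sub_sq_cpow hx hc
  -- The endpoint y = x, where the base of the power is 0, is discarded as a null set.
  have hne : ∀ᵐ y : ℝ, y ≠ x := by simp [ae_iff, measure_singleton]
  have h := intervalIntegral.hasSum_integral_of_dominated_convergence (μ := volume)
    (a := 0) (b := x)
    (F := fun (j : ℕ) (y : ℝ) =>
      (besselCoeff N j : ℂ) * (((x ^ 2 - y ^ 2 : ℝ) : ℂ) ^ c * (y : ℂ) ^ (2 * j + 1)))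
    (f := remainderIntegrand N x τ)
    (fun j _ => (x ^ 2) ^ c.re * ((x ^ 2) ^ j / j.factorial * x)) ?_ ?_ ?_ ?_ ?_
  · refine h.congr_fun fun j => ?_
    rw [intervalIntegral.integral_const_mul, integral_sq_sub_sq_cpow_mul_pow hx j hc]
  · intro j
    have h := ((hint.mul_continuousOn (g := fun y : ℝ => (y : ℂ) ^ (2 * j + 1))
      (by fun_prop)).const_mul (besselCoeff N j : ℂ))
    rw [intervalIntegrable_iff] at h
    exact h.aestronglyMeasurable
  · intro j
    filter_upwards [hne] with y hyx hy
    rw [Set.uIoc_of_le hx.le] at hy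
    have hy' : y ∈ Set.Ioo 0 x := ⟨hy.1, lt_of_le_of_ne hy.2 hyx⟩
    rw [mul_left_comm, norm_mul]
    exact mul_le_mul (norm_ofReal_cpow_le (sq_sub_sq_pos hy') (by nlinarith [sq_nonneg y]) hc)
      (norm_besselCoeff_mul_pow_le N j hy.1.le hy.2) (norm_nonneg _) (by positivity)
  · exact Eventually.of_forall fun y _ => (summable_sq_pow_div_factorial_mul x).mul_left _
  · exact intervalIntegrable_const
  · refine Eventually.of_forall fun y hy => ?_
    rw [Set.uIoc_of_le hx.le] at hy
    have := (hasSum_besselI_div_pow N hy.1).mul_left (((x ^ 2 - y ^ 2 : ℝ) : ℂ) ^ c)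
    rw [← mul_div_assoc] at this
    refine this.congr_fun fun j => ?_
    ring

/-- Termwise: the Beta integral cancels j!, the two Pochhammer factors combine into (1 -
iτ)_{N+1+j}, and x^{2iτ} removes the imaginary part of the exponent of x². -/
theorem tail_besselSeries_eq (N : ℕ) {x τ : ℝ} (hx : 0 < x) (hτ : 0 < τ) :
    ∑' j : ℕ, ((x : ℂ) / 2) ^ (2 * (j + (N + 1))) /
        (((j + (N + 1)).factorial : ℂ) * pochOneSub τ (j + (N + 1))) =
      (x : ℂ) ^ (2 * Complex.I * (τ : ℂ)) / ((2 : ℂ) ^ N * pochOneSub τ N) *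
          ∫ y in (0 : ℝ)..x, remainderIntegrand N x τ y := by
  rw [← (hasSum_integral_remainderIntegrand N hx τ).tsum_eq, ← tsum_mul_left]
  refine tsum_congr fun j => ?_
  have hx2 : ((x ^ 2 : ℝ) : ℂ) ≠ 0 := Complex.ofReal_ne_zero.2 (by positivity)
  have hx0 : (x : ℂ) ≠ 0 := Complex.ofReal_ne_zero.2 hx.ne'
  have hpow : (x : ℂ) ^ (2 * Complex.I * (τ : ℂ)) *
      ((x ^ 2 : ℝ) : ℂ) ^ ((N : ℂ) - Complex.I * τ + j + 1) = (x : ℂ) ^ (2 * (j + (N + 1))) := by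
    rw [show (N : ℂ) - Complex.I * τ + j + 1 = -(Complex.I * τ) + ((j + (N + 1) : ℕ) : ℂ) by
      push_cast; ring, Complex.cpow_add _ _ hx2, Complex.cpow_natCast, ← mul_assoc,
      Complex.cpow_def_of_ne_zero hx2, Complex.cpow_def_of_ne_zero hx0, ← Complex.exp_add,
      ← Complex.ofReal_log (sq_nonneg x), ← Complex.ofReal_log hx.le, Real.log_pow, pow_mul]
    have : (Real.log x : ℂ) * (2 * Complex.I * τ) +
        ((2 : ℕ) * Real.log x : ℝ) * -(Complex.I * τ) = 0 := by push_cast; ring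
    rw [this, Complex.exp_zero, one_mul, Complex.ofReal_pow]
  have hP : pochOneSub τ (j + (N + 1)) =
      pochOneSub τ N * (ascPochhammer ℂ (j + 1)).eval ((N : ℂ) - Complex.I * τ + 1) := by
    rw [show j + (N + 1) = N + (j + 1) by ring, pochOneSub_add]
    congr 2
    ring
  have h0 := pochOneSub_ne_zero hτ (j + (N + 1))
  rw [hP] at h0 ⊢
  have h1 := left_ne_zero_of_mul h0
  have h2 := right_ne_zero_of_mul h0
  rw [div_pow, ← hpow, besselCoeff, show j + N + 1 = j + (N + 1) by ring]
  have hj : (j.factorial : ℂ) ≠ 0 := Nat.cast_ne_zero.2 j.factorial_ne_zero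
  have hjN : ((j + (N + 1)).factorial : ℂ) ≠ 0 := Nat.cast_ne_zero.2 (Nat.factorial_ne_zero _)
  push_cast
  field_simp
  ring

theorem besselSeries_eq (N : ℕ) {x τ : ℝ} (hx : 0 < x) (hτ : 0 < τ) :
    besselSeries x τ = 1 + (∑ m ∈ Finset.Icc 1 N,
          ((x : ℂ) / 2) ^ (2 * m) / ((m.factorial : ℂ) * pochOneSub τ m) +
        (x : ℂ) ^ (2 * Complex.I * (τ : ℂ)) / ((2 : ℂ) ^ N * pochOneSub τ N) *
          ∫ y in (0 : ℝ)..x, remainderIntegrand N x τ y) := by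
  rw [← tail_besselSeries_eq N hx hτ, besselSeries,
    ← (summable_besselSeries x hτ).sum_add_tsum_nat_add (N + 1), ← add_assoc,
    Finset.range_eq_Ico, Finset.sum_eq_sum_Ico_succ_bot (by omega)]
  congr 1
  simp [pochOneSub]
  rfl

/-! ### Estimates for the remainder. -/

/-- Without its constant term, each term of the majorant carries (τ₀/τ)^{k+1} ≤ τ₀/τ, so one factor
1/τ comes out and an exponential series in X²/(4τ₀) remains. -/
theorem norm_besselSeries_sub_one_le {x X τ₀ τ : ℝ} (hx : 0 < x) (hxX : x ≤ X) (h₀ : 0 < τ₀)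
    (hτ : τ₀ ≤ τ) :
    ‖besselSeries x τ - 1‖ ≤ τ₀ / τ * (Real.exp (X ^ 2 / (4 * τ₀)) - 1) := by
  have hτ0 : 0 < τ := h₀.trans_le hτ
  have h1 : besselSeries x τ - 1 = ∑' k : ℕ, ((x : ℂ) / 2) ^ (2 * (k + 1)) /
      (((k + 1).factorial : ℂ) * pochOneSub τ (k + 1)) := by
    rw [besselSeries, ← (summable_besselSeries x hτ0).sum_add_tsum_nat_add 1]
    simp [pochOneSub]
  have hs : HasSum (fun k : ℕ => (X ^ 2 / (4 * τ₀)) ^ (k + 1) / (k + 1).factorial)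
      (Real.exp (X ^ 2 / (4 * τ₀)) - 1) := by
    have h := NormedSpace.expSeries_div_hasSum_exp (𝔸 := ℝ) (X ^ 2 / (4 * τ₀))
    rw [← Real.exp_eq_exp_ℝ] at h
    simpa using (hasSum_nat_add_iff' 1).2 h
  rw [h1]
  refine tsum_of_norm_bounded (hs.mul_left (τ₀ / τ)) fun k => ?_
  refine (norm_besselSeries_term_le hτ0 (k + 1)).trans ?_
  have h2 : (x ^ 2 / (4 * τ)) ^ (k + 1) ≤ τ₀ / τ * (X ^ 2 / (4 * τ₀)) ^ (k + 1) := by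
    have e1 : x ^ 2 / (4 * τ) ≤ τ₀ / τ * (X ^ 2 / (4 * τ₀)) := by
      have : τ₀ / τ * (X ^ 2 / (4 * τ₀)) = X ^ 2 / (4 * τ) := by field_simp
      rw [this]; gcongr
    have e2 : τ₀ / τ ≤ 1 := (div_le_one hτ0).2 hτ
    calc _ ≤ (τ₀ / τ * (X ^ 2 / (4 * τ₀))) ^ (k + 1) := by gcongr
      _ = (τ₀ / τ) ^ (k + 1) * (X ^ 2 / (4 * τ₀)) ^ (k + 1) := mul_pow _ _ _
      _ ≤ _ := by
        gcongr
        exact pow_le_of_le_one (by positivity) e2 (by omega)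
  rw [← mul_div_assoc]
  gcongr

theorem remainder_eq (N : ℕ) {x τ : ℝ} (hx : 0 < x) (hτ : 0 < τ) :
    remainder N x τ = (Complex.exp (Complex.I * (phase x τ : ℂ)) *
      (stirlingRemainder τ + (1 + stirlingRemainder τ) * (besselSeries x τ - 1))).re := by
  rw [remainder, besselSeries_eq N hx hτ, add_sub_cancel_left]

theorem cos_phase_add_remainder (N : ℕ) {x τ : ℝ} (hx : 0 < x) (hτ : 0 < τ) :
    Real.cos (phase x τ) + remainder N x τ = (Complex.exp (Complex.I * (phase x τ : ℂ)) *
      ((1 + stirlingRemainder τ) * besselSeries x τ)).re := by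
  have hcos : Real.cos (phase x τ) = (Complex.exp (Complex.I * (phase x τ : ℂ))).re := by
    rw [mul_comm, Complex.exp_ofReal_mul_I_re]
  rw [remainder_eq N hx hτ, hcos, ← Complex.add_re]
  congr 1
  ring

theorem abs_remainder_le (N : ℕ) {x X τ₀ τ : ℝ} (hx : 0 < x) (hxX : x ≤ X) (h₀ : 0 < τ₀)
    (hτ : τ₀ ≤ τ) :
    |remainder N x τ| ≤ 1 / τ * (Real.exp (1 / (6 * τ₀)) / 6 +
      (τ₀ + Real.exp (1 / (6 * τ₀)) / 6) * (Real.exp (X ^ 2 / (4 * τ₀)) - 1)) := by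
  have hτ0 : 0 < τ := h₀.trans_le hτ
  set E := Real.exp (1 / (6 * τ₀))
  have hE : 0 < E := Real.exp_pos _
  have hr := norm_stirlingRemainder_le h₀ hτ
  have hS := norm_besselSeries_sub_one_le hx hxX h₀ hτ
  have hA : 0 ≤ Real.exp (X ^ 2 / (4 * τ₀)) - 1 := by
    have := Real.one_le_exp (show 0 ≤ X ^ 2 / (4 * τ₀) by positivity)
    linarith
  set A := Real.exp (X ^ 2 / (4 * τ₀)) - 1
  have h1r : ‖1 + stirlingRemainder τ‖ ≤ 1 + E / (6 * τ₀) := by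
    refine (norm_add_le _ _).trans ?_
    rw [norm_one]
    have : E / (6 * τ) ≤ E / (6 * τ₀) := by gcongr
    linarith
  rw [remainder_eq N hx hτ0]
  refine (Complex.abs_re_le_norm _).trans ?_
  rw [norm_mul, mul_comm Complex.I, Complex.norm_exp_ofReal_mul_I, one_mul]
  calc _ ≤ ‖stirlingRemainder τ‖ + ‖1 + stirlingRemainder τ‖ * ‖besselSeries x τ - 1‖ := by
        rw [← norm_mul]; exact norm_add_le _ _
    _ ≤ E / (6 * τ) + (1 + E / (6 * τ₀)) * (τ₀ / τ * A) := by gcongr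
    _ = _ := by field_simp

/-- The left side is the k = 0 term of a series of nonnegative terms. It makes the I_N term of the
final bound nonnegative. -/
theorem inv_two_pow_mul_factorial_le_besselI (N : ℕ) {X : ℝ} (hX : 0 < X) :
    1 / (2 ^ N * (N.factorial : ℝ)) ≤ (besselI (N : ℂ) (X : ℂ)).re / X ^ N := by
  have h : besselI (N : ℂ) (X : ℂ) =
      ((∑' k : ℕ, (X / 2) ^ (2 * k + N) /
        ((k.factorial : ℝ) * ((k + N).factorial : ℝ)) : ℝ) : ℂ) := by
    rw [besselI, Complex.ofReal_tsum]
    refine tsum_congr fun k => ?_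
    rw [show (2 * (k : ℂ) + (N : ℂ)) = ((2 * k + N : ℕ) : ℂ) by push_cast; ring,
      show ((k : ℂ) + (N : ℂ) + 1) = ((k + N : ℕ) : ℂ) + 1 by push_cast; ring,
      Complex.cpow_natCast, Complex.Gamma_nat_eq_factorial]
    push_cast
    ring
  have hs : Summable fun k : ℕ => (X / 2) ^ (2 * k + N) /
      ((k.factorial : ℝ) * ((k + N).factorial : ℝ)) := by
    refine Summable.of_nonneg_of_le (fun k => by positivity) (fun k => ?_)
      ((Real.summable_pow_div_factorial ((X / 2) ^ 2)).mul_right ((X / 2) ^ N))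
    have h1 : (1 : ℝ) ≤ (k + N).factorial := by exact_mod_cast (k + N).factorial_pos
    have hk : (0 : ℝ) < k.factorial := by exact_mod_cast k.factorial_pos
    calc _ ≤ (X / 2) ^ (2 * k + N) / ((k.factorial : ℝ) * 1) := by gcongr
      _ = _ := by rw [pow_add, pow_mul]; ring
  rw [h, Complex.ofReal_re, le_div_iff₀ (by positivity)]
  refine le_trans (le_of_eq ?_) (hs.le_tsum 0 fun k _ => by positivity)
  simp only [mul_zero, zero_add, Nat.factorial_zero, Nat.cast_one, one_mul, div_pow]
  field_simp

theorem theorem1 (N : ℕ) (X : ℝ) (hX : 0 < X) :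
    -- the improper integral in `r(τ)` converges
    (∀ τ : ℝ, 0 < τ →
      (∀ T : ℝ, 0 < T → IntervalIntegrable (binetIntegrand τ) volume 0 T) ∧
      Tendsto (fun T : ℝ => ∫ t in (0 : ℝ)..T, binetIntegrand τ t) atTop
        (𝓝 (binetIntegral τ))) ∧
    (∀ x : ℝ, 0 < x → x ≤ X →
      -- the expansion with the explicit remainder
      (∀ τ : ℝ, 0 < τ →
        IntervalIntegrable (remainderIntegrand N x τ) volume 0 x ∧
        besselK (Complex.I * (τ : ℂ)) (x : ℂ) =
          ((Real.sqrt (2 * Real.pi / τ) * Real.exp (-(Real.pi * τ / 2)) *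
            (Real.cos (τ * Real.log (2 * τ / (Real.exp 1 * x)) - Real.pi / 4) +
              remainder N x τ) : ℝ) : ℂ)) ∧
      -- the remainder is of order `1 / τ`
      (fun τ : ℝ => remainder N x τ) =O[atTop] (fun τ : ℝ => 1 / τ) ∧
      -- the explicit bound
      (∀ τ₀ τ : ℝ, 0 < τ₀ → τ₀ ≤ τ →
        |remainder N x τ| ≤
          1 / τ * (Real.exp (1 / (6 * τ₀)) / 6 +
            (τ₀ + Real.exp (1 / (6 * τ₀)) / 6) *
              (Real.exp (X ^ 2 / (4 * τ₀)) +
                (X ^ 2 / (2 * τ₀)) ^ N *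
                  ((besselI (N : ℂ) (X : ℂ)).re / X ^ N -
                    1 / (2 ^ N * (N.factorial : ℝ))))))) := by
  have hbound : ∀ x : ℝ, 0 < x → x ≤ X → ∀ τ₀ τ : ℝ, 0 < τ₀ → τ₀ ≤ τ →
        |remainder N x τ| ≤
          1 / τ * (Real.exp (1 / (6 * τ₀)) / 6 +
            (τ₀ + Real.exp (1 / (6 * τ₀)) / 6) *
              (Real.exp (X ^ 2 / (4 * τ₀)) +
                (X ^ 2 / (2 * τ₀)) ^ N *
                  ((besselI (N : ℂ) (X : ℂ)).re / X ^ N -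
                    1 / (2 ^ N * (N.factorial : ℝ))))) := by
    intro x hx hxX τ₀ τ h₀ hτ
    have hτ0 : 0 < τ := h₀.trans_le hτ
    have hI := sub_nonneg.2 (inv_two_pow_mul_factorial_le_besselI N hX)
    have hp : 0 ≤ (X ^ 2 / (2 * τ₀)) ^ N *
        ((besselI (N : ℂ) (X : ℂ)).re / X ^ N - 1 / (2 ^ N * (N.factorial : ℝ))) :=
      mul_nonneg (by positivity) hI
    -- The bound already proved has -1 where the stated one has a nonnegative term.
    refine (abs_remainder_le N hx hxX h₀ hτ).trans ?_
    gcongr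
    linarith
  refine ⟨fun τ hτ => ⟨fun T hT => intervalIntegrable_binetIntegrand τ hT, ?_⟩,
    fun x hx hxX => ⟨fun τ hτ => ⟨intervalIntegrable_remainderIntegrand N hx τ, ?_⟩, ?_,
      hbound x hx hxX⟩⟩
  · rw [binetIntegral_eq_binetFun hτ]
    exact tendsto_integral_binetIntegrand hτ
  · rw [besselK_I_mul_eq hx hτ, ← cos_phase_add_remainder N hx hτ, phase]
  -- The explicit bound at τ₀ = 1 supplies the constant.
  · refine Asymptotics.IsBigO.of_bound (Real.exp (1 / (6 * 1)) / 6 +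
      (1 + Real.exp (1 / (6 * 1)) / 6) * (Real.exp (X ^ 2 / (4 * 1)) +
        (X ^ 2 / (2 * 1)) ^ N * ((besselI (N : ℂ) (X : ℂ)).re / X ^ N -
          1 / (2 ^ N * (N.factorial : ℝ))))) ?_
    filter_upwards [eventually_ge_atTop 1] with τ hτ
    have h := hbound x hx hxX 1 τ one_pos hτ
    rw [Real.norm_eq_abs, Real.norm_of_nonneg (by positivity), mul_comm]
    exact h
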